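/- Let $E$ be a finite set with its discrete $\sigma$-algebra and let $(X_t)_{t\ge 0}$ be an irreducible Markov jump process on $E$ with starting measures $(\mathbb P_x)_{x\in E}$: the paths are right continuous, $\mathbb P_x(X_0=x)=1$, for every $x\in E$, $t\ge 0$ and every bounded measurable $A:E^{[0,\infty)}\to\mathbb R$ one has $\mathbb E_x[A((X_{t+s})_{s\ge0})\mid (X_r)_{r\le t}]=\mathbb E_x[A((X_{t+s})_{s\ge0})\mid X_t]=\mathbb E_{X_t}[A((X_s)_{s\ge0})]$ $\mathbb P_x$-a.s., and $\mathbb P_x(\exists\, t\ge 0: X_t=y)>0$ for all $x,y\in E$. Let $p_{xy}(t)=\mathbb P_x(X_t=y)$ and let $\pi$ be an invariant distribution, i.e. a probability vector with $\sum_x\pi_x p_{xy}(t)=\pi_y$ for all $t\ge0$, $y\in E$. Then $\pi_x>0$ for all $x$, and the limit $(Lg)(x)=\lim_{h\downarrow 0}\frac{\mathbb E_x[g(X_h)]-g(x)}{h}$ exists for all $g\in\mathbb R^E$, $x\in E$. The linear operator $L$ on $L^2(\pi)=\mathbb R^E$ is the infinitesimal generator of the process. Write $\langle g,h\rangle=\sum_x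 g(x)h(x)\pi_x$ and $\|g\|_2=\langle g,g\rangle^{1/2}$, and let $L^*$ be the adjoint of $L$ with respect to $\langle\cdot,\cdot\rangle$. Let $f:E\to\mathbb R$ satisfy $\pi(f)=\sum_x f(x)\pi_x=0$, let $(M_fg)(x)=f(x)g(x)$, let $\nu$ be a probability vector on $E$, $\frac{d\nu}{d\pi}(x)=\nu_x/\pi_x$, $\mathbb P_\nu=\sum_x\nu_x\mathbb P_x$, and $A_t=\int_0^t f(X_s)\,ds$. For $r\in\mathbb R$ let $\lambda_0(r)$ be the largest eigenvalue of $\frac{L+L^*}{2}+rM_f$ (which exists), and for $u\in\mathbb R$ let $$\lambda_0^*(u)=\sup_{r\in\mathbb R}\,(ru-\lambda_0(r))\in[-\infty,\infty],\qquad I(u)=\inf\{-\langle Lg,g\rangle : g\in\mathbb R^E,\ \|g\|_2=1,\ \langle M_fg,g\rangle=u\},$$ with $\inf\emptyset=\infty$. Then: 1. for all $u\ge 0$ and all $t>0$, $\displaystyle \mathbb P_\nu\Big(\frac{A_t}{t}\ge u\Big)\le \Big\|\frac{d\nu}{d\pi}\Big\|_2\, e^{-t\lambda_0^*(u)}$ (with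 $e^{-\infty}=0$); 2. for all $u\ge 0$, $\displaystyle \lambda_0^*(u)=\sup_{r\ge 0}\,(ru-\lambda_0(r))$; 3. for all $u\in\mathbb R$, $\lambda_0^*(u)=I(u)$. -/

import Mathlib

open MeasureTheory Filter Topology
open scoped NNReal ENNReal

noncomputable section

namespace MarkovJump

variable {E Ω : Type*}

/-- A Markov jump process `(X, (P x)_{x ∈ E})` on a finite (discrete) state space `E`: a family of
probability measures `P x` on `Ω` and a process with right continuous (piecewise constant) paths,
started from `x` under `P x`, and with the Markov property for every bounded measurable
functional `A` of the path:
`E_x[A((X_{t+s})_s) | (X_r)_{r ≤ t}] = E_x[A((X_{t+s})_s) | X_t] = E_{X_t}[A((X_s)_s)]`. -/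
structure IsMarkovJumpProcess [MeasurableSpace E] [MeasurableSpace Ω]
    (X : ℝ≥0 → Ω → E) (P : E → Measure Ω) : Prop where
  isProbabilityMeasure : ∀ x, IsProbabilityMeasure (P x)
  measurable : ∀ t, Measurable (X t)
  jump : ∀ (ω : Ω) (t : ℝ≥0), ∃ ε : ℝ≥0, 0 < ε ∧ ∀ h ≤ ε, X (t + h) ω = X t ω
  start : ∀ x, P x {ω | X 0 ω = x} = 1
  markov : ∀ (x : E) (t : ℝ≥0) (A : (ℝ≥0 → E) → ℝ), Measurable A → (∃ C : ℝ, ∀ w, |A w| ≤ C) →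
    (P x)[fun ω => A (fun s => X (t + s) ω) |
        ⨆ r : Set.Iic t, MeasurableSpace.comap (X r) inferInstance]
      =ᵐ[P x] (fun ω => ∫ ω', A (fun s => X s ω') ∂(P (X t ω))) ∧
    (P x)[fun ω => A (fun s => X (t + s) ω) | MeasurableSpace.comap (X t) inferInstance]
      =ᵐ[P x] (fun ω => ∫ ω', A (fun s => X s ω') ∂(P (X t ω)))

/-- The transition function `p_{xy}(t) = P_x(X_t = y)`. -/
def transition [MeasurableSpace Ω] (X : ℝ≥0 → Ω → E) (P : E → Measure Ω) (t : ℝ≥0) :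
    Matrix E E ℝ :=
  Matrix.of fun x y => (P x).real {ω | X t ω = y}

/-- Irreducibility: from every state, every state is reached with positive probability. -/
def Irreducible [MeasurableSpace Ω] (X : ℝ≥0 → Ω → E) (P : E → Measure Ω) : Prop :=
  ∀ x y, 0 < P x {ω | ∃ t, X t ω = y}

/-- `π` is an invariant distribution: a probability vector with `πᵀ P(t) = πᵀ` for all `t ≥ 0`. -/
def IsInvariant [Fintype E] [MeasurableSpace Ω] (X : ℝ≥0 → Ω → E) (P : E → Measure Ω)
    (π : E → ℝ) : Prop :=
  π ∈ stdSimplex ℝ E ∧ ∀ t, Matrix.vecMul π (transition X P t) = π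

/-- The law `P_ν = ∑_x ν_x P_x` of the process with initial distribution `ν`. -/
def lawFrom [Fintype E] [MeasurableSpace Ω] (P : E → Measure Ω) (ν : E → ℝ) : Measure Ω :=
  ∑ x, ENNReal.ofReal (ν x) • P x

/-- The additive functional `A_t = ∫_0^t f(X_s) ds`. -/
def additive (X : ℝ≥0 → Ω → E) (f : E → ℝ) (t : ℝ) (ω : Ω) : ℝ :=
  ∫ s in (0 : ℝ)..t, f (X s.toNNReal ω)

/-- The transition semigroup `(P_t g)(x) = E_x[g(X_t)]`. -/
def semigroup [MeasurableSpace Ω] (X : ℝ≥0 → Ω → E) (P : E → Measure Ω) (t : ℝ≥0) (g : E → ℝ) :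
    E → ℝ :=
  fun x => ∫ ω, g (X t ω) ∂(P x)

/-- The `Q`-matrix: the matrix of right derivatives at `0` of the transition function. -/
def qMatrix [MeasurableSpace Ω] (X : ℝ≥0 → Ω → E) (P : E → Measure Ω) : Matrix E E ℝ :=
  Matrix.of fun x y => derivWithin (fun h : ℝ => transition X P h.toNNReal x y) (Set.Ici 0) 0

/-- The infinitesimal generator, as an operator on `L²(π) = ℝ^E`. -/
def generator [Fintype E] [MeasurableSpace Ω] (X : ℝ≥0 → Ω → E) (P : E → Measure Ω) :
    (E → ℝ) →ₗ[ℝ] (E → ℝ) :=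
  (qMatrix X P).mulVecLin

/-- The inner product of `L²(π)`. -/
def innerL2 [Fintype E] (π g h : E → ℝ) : ℝ := ∑ x, g x * h x * π x

/-- The norm of `L²(π)`. -/
def normL2 [Fintype E] (π g : E → ℝ) : ℝ := √(innerL2 π g g)

/-- The matrix of the adjoint in `L²(π)` of the operator with matrix `Q` (for positive `π`;
see `innerL2_adjointMatrix`). -/
def adjointMatrix (π : E → ℝ) (Q : Matrix E E ℝ) : Matrix E E ℝ :=
  Matrix.of fun x y => π y * Q y x / π x

theorem innerL2_adjointMatrix [Fintype E] (π : E → ℝ) (hπ : ∀ x, 0 < π x) (Q : Matrix E E ℝ)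
    (g h : E → ℝ) :
    innerL2 π ((adjointMatrix π Q).mulVecLin g) h = innerL2 π g (Q.mulVecLin h) := by
  simp only [innerL2, Matrix.mulVecLin_apply, Matrix.mulVec, dotProduct, adjointMatrix,
    Matrix.of_apply, Finset.sum_mul, Finset.mul_sum]
  rw [Finset.sum_comm]
  refine Finset.sum_congr rfl fun y _ => Finset.sum_congr rfl fun x _ => ?_
  have := (hπ x).ne'
  field_simp

/-- The adjoint `L*` in `L²(π)` of the generator. -/
def generatorAdjoint [Fintype E] [MeasurableSpace Ω] (X : ℝ≥0 → Ω → E) (P : E → Measure Ω)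
    (π : E → ℝ) : (E → ℝ) →ₗ[ℝ] (E → ℝ) :=
  (adjointMatrix π (qMatrix X P)).mulVecLin

/-- The operator `(L + L*)/2 + r M_f`, where `M_f` is multiplication by `f`. -/
def tilted [Fintype E] [MeasurableSpace Ω] (X : ℝ≥0 → Ω → E) (P : E → Measure Ω)
    (π f : E → ℝ) (r : ℝ) : (E → ℝ) →ₗ[ℝ] (E → ℝ) :=
  (1 / 2 : ℝ) • (generator X P + generatorAdjoint X P π) + r • LinearMap.mulLeft ℝ f

/-- The set of (real) eigenvalues of an operator on `ℝ^E`. -/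
def eigenvalues (T : (E → ℝ) →ₗ[ℝ] (E → ℝ)) : Set ℝ := {μ | Module.End.HasEigenvalue T μ}

/-- `λ₀(r)`: the largest eigenvalue of `(L + L*)/2 + r M_f`. -/
def topEigenvalue [Fintype E] [MeasurableSpace Ω] (X : ℝ≥0 → Ω → E) (P : E → Measure Ω)
    (π f : E → ℝ) (r : ℝ) : ℝ :=
  sSup (eigenvalues (tilted X P π f r))

/-- The Fenchel conjugate `F*(u) = sup_{r ∈ D} (r u - F(r)) ∈ [-∞, ∞]` with respect to `D ⊆ ℝ`. -/
def fenchel (D : Set ℝ) (F : ℝ → ℝ) (u : ℝ) : EReal :=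
  ⨆ r ∈ D, ((r * u - F r : ℝ) : EReal)

/-- `I(u) = inf {-⟨L g, g⟩ : ‖g‖₂ = 1, ⟨M_f g, g⟩ = u}`, with `inf ∅ = ∞`. -/
def rateFunction [Fintype E] [MeasurableSpace Ω] (X : ℝ≥0 → Ω → E) (P : E → Measure Ω)
    (π f : E → ℝ) (u : ℝ) : EReal :=
  ⨅ g ∈ {g : E → ℝ | normL2 π g = 1 ∧ innerL2 π (LinearMap.mulLeft ℝ f g) g = u},
    ((-innerL2 π (generator X P g) g : ℝ) : EReal)

end MarkovJump

end

namespace MarkovJump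

/-! ### Differentiability of bounded semigroups that are continuous at zero. -/

section Semigroup

variable {A : Type*} [NormedRing A]

/-! Symmetrising `L` leaves its quadratic form unchanged, so λ₀(r) is the maximum of ⟨Lg,g⟩ +
r⟨fg,g⟩ over the unit sphere of L²(π) (`topEigenvalue_spec`). All three claims rest on this.

Tail bound: for r ≥ 0, Chernoff reduces it to E_ν[exp(r A_t)] ≤ ‖dν/dπ‖₂ exp(tλ₀(r)). Instead of a
continuous-time Feynman–Kac semigroup, A_t is replaced by Riemann sums. By the Markov property the
exponential moment of such a sum is the n-th iterate on 1 of W_h g = P_h(exp(hrf) g), h = t/n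
(`integral_prod`). A first-order expansion at h = 0 gives ‖W_h g‖² ≤ exp(h(2λ₀(r)+ε))‖g‖² uniformly
in g (`eventually_weightedStep_le`); iterate, apply Cauchy–Schwarz against dν/dπ, then let n → ∞ and
ε → 0.

Restriction to r ≥ 0: the constant function 1 shows λ₀ ≥ 0, since L1 = 0 and π(f) = 0, while λ₀(0) =
0. For u ≥ 0 negative r therefore never beat r = 0.

Variational formula: λ₀* ≤ I is weak duality. The reverse is strong duality, although the problem is
not convex in g. Its constraints are linear in g², and replacing g₁, g₂ by √(a g₁² + b g₂²) does not
raise the energy because off-diagonal rates are nonnegative. So the set of pairs (constraint value,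
energy bound) is convex and closed, and Hahn–Banach yields a multiplier (`exists_multiplier`). -/

theorem continuous_of_semigroup {p : ℝ≥0 → A} (hadd : ∀ s t, p (s + t) = p s * p t)
    (h0 : Tendsto p (𝓝 0) (𝓝 1)) {C : ℝ} (hC : ∀ t, ‖p t‖ ≤ C) : Continuous p := by
  have key : ∀ s t : ℝ≥0, s ≤ t → ‖p t - p s‖ ≤ C * ‖p (t - s) - 1‖ := by
    intro s t hst
    have : p t - p s = p s * (p (t - s) - 1) := by
      rw [mul_sub, mul_one, ← hadd, add_tsub_cancel_of_le hst]
    rw [this]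
    exact (norm_mul_le _ _).trans (mul_le_mul_of_nonneg_right (hC s) (norm_nonneg _))
  have key2 : ∀ s t : ℝ≥0, ‖p s - p t‖ ≤ C * ‖p (nndist s t) - 1‖ := by
    intro s t
    rcases le_total s t with h | h
    · have e : nndist s t = t - s := by
        rw [NNReal.nndist_eq, max_eq_right]
        rw [tsub_eq_zero_of_le h]; exact zero_le
      rw [e, norm_sub_rev]; exact key s t h
    · have e : nndist s t = s - t := by
        rw [NNReal.nndist_eq, max_eq_left]
        rw [tsub_eq_zero_of_le h]; exact zero_le
      rw [e]; exact key t s h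
  rw [continuous_iff_continuousAt]
  intro t
  rw [ContinuousAt, tendsto_iff_norm_sub_tendsto_zero]
  have h1 : Tendsto (fun s => nndist s t) (𝓝 t) (𝓝 0) := by
    have : Continuous fun s : ℝ≥0 => nndist s t := by fun_prop
    simpa using this.tendsto t
  have h2 : Tendsto (fun s => C * ‖p (nndist s t) - 1‖) (𝓝 t) (𝓝 0) := by
    have := (((h0.comp h1).sub_const 1).norm).const_mul C
    simpa using this
  exact squeeze_zero (fun _ => norm_nonneg _) (fun s => key2 s t) h2

/-- With F(x) = ∫₀ˣ q, the semigroup law gives q(h) F(δ) = F(h+δ) − F(h). Since F(δ)/δ → 1 and units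
are open, F(δ) is invertible for some δ > 0, so q inherits the differentiability of F. -/
theorem exists_hasDerivWithinAt_of_semigroup [NormedAlgebra ℝ A] [CompleteSpace A] {p : ℝ≥0 → A}
    (hadd : ∀ s t, p (s + t) = p s * p t)
    (h0 : Tendsto p (𝓝 0) (𝓝 1)) (hp0 : p 0 = 1) {C : ℝ} (hC : ∀ t, ‖p t‖ ≤ C) :
    ∃ Q : A, HasDerivWithinAt (fun h : ℝ => p h.toNNReal) Q (Set.Ici 0) 0 := by
  have hcont : Continuous fun s : ℝ => p s.toNNReal :=
    (continuous_of_semigroup hadd h0 hC).comp continuous_real_toNNReal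
  set q : ℝ → A := fun s => p s.toNNReal with hq
  set F : ℝ → A := fun x => ∫ s in (0 : ℝ)..x, q s with hF
  have hFd : ∀ x, HasDerivAt F (q x) x := fun x =>
    (hcont.integral_hasStrictDerivAt 0 x).hasDerivAt
  have hunit : ∃ δ : ℝ, 0 < δ ∧ IsUnit (F δ) := by
    have h1 := (hFd 0).hasDerivWithinAt (s := Set.Ioi 0)
    rw [hasDerivWithinAt_iff_tendsto_slope' (by simp)] at h1
    have hq0 : q 0 = 1 := by simp [hq, hp0]
    rw [hq0] at h1
    have h2 := h1.eventually (Units.isOpen.mem_nhds (isUnit_one (M := A)))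
    obtain ⟨δ, hδ, hδ0⟩ := (h2.and self_mem_nhdsWithin).exists
    refine ⟨δ, hδ0, ?_⟩
    have hδ1 : slope F 0 δ = δ⁻¹ • F δ := by simp [slope, hF]
    have : F δ = δ • slope F 0 δ := by
      rw [hδ1, smul_smul, mul_inv_cancel₀ (ne_of_gt hδ0), one_smul]
    rw [this]
    have hd : δ ≠ 0 := ne_of_gt hδ0
    have h3 : IsUnit (algebraMap ℝ A δ) := (IsUnit.mk0 δ hd).map _
    rw [Algebra.smul_def]
    exact h3.mul hδ
  obtain ⟨δ, hδ, U, hU⟩ := hunit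
  have hrep : ∀ h : ℝ, 0 ≤ h → q h = (F (h + δ) - F h) * (↑U⁻¹ : A) := by
    intro h hh
    rw [Units.eq_mul_inv_iff_mul_eq, hU]
    have e1 : F (h + δ) - F h = ∫ s in h..(h + δ), q s :=
      intervalIntegral.integral_interval_sub_left (hcont.intervalIntegrable _ _)
        (hcont.intervalIntegrable _ _)
    rw [e1]
    have e2 : ∫ s in h..(h + δ), q s = ∫ s in (0 : ℝ)..δ, q (h + s) := by
      rw [intervalIntegral.integral_comp_add_left]; simp
    rw [e2, hF]
    change q h * ∫ s in (0 : ℝ)..δ, q s = _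
    have e3 := (ContinuousLinearMap.mul ℝ A (q h)).intervalIntegral_comp_comm
      (hcont.intervalIntegrable (μ := volume) 0 δ)
    rw [ContinuousLinearMap.mul_apply'] at e3
    rw [← e3]
    refine intervalIntegral.integral_congr fun s hs => ?_
    rw [Set.uIcc_of_le hδ.le] at hs
    simp only [hq, ContinuousLinearMap.mul_apply']
    rw [Real.toNNReal_add hh hs.1, hadd]
  refine ⟨(q (0 + δ) - q 0) * (↑U⁻¹ : A), ?_⟩
  have hd : HasDerivAt (fun h => (F (h + δ) - F h) * (↑U⁻¹ : A))
      ((q (0 + δ) - q 0) * (↑U⁻¹ : A)) 0 :=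
    (((hFd (0 + δ)).comp_add_const 0 δ).sub (hFd 0)).mul_const _
  exact hd.hasDerivWithinAt.congr (fun h hh => hrep h hh) (hrep 0 le_rfl)

end Semigroup

/-! ### Transition matrices, the invariant distribution and the generator. -/

variable {E Ω : Type*} [MeasurableSpace Ω] {X : ℝ≥0 → Ω → E} {P : E → Measure Ω}

theorem transition_nonneg (t : ℝ≥0) (x y : E) : 0 ≤ transition X P t x y := measureReal_nonneg

variable [MeasurableSpace E]

theorem IsMarkovJumpProcess.eventually_eq (hX : IsMarkovJumpProcess X P) (ω : Ω) (t : ℝ≥0) :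
    ∀ᶠ s in 𝓝[≥] t, X s ω = X t ω := by
  obtain ⟨ε, hε, h⟩ := hX.jump ω t
  have : Set.Icc t (t + ε) ∈ 𝓝[≥] t := Icc_mem_nhdsGE (lt_add_of_pos_right t hε)
  filter_upwards [this] with s hs
  have := h (s - t) (tsub_le_iff_left.2 hs.2)
  rwa [add_tsub_cancel_of_le hs.1] at this

/-- A path that visits y stays there for a positive time, hence occupies y at a rational time. The
hitting event is thus covered by countably many events, which cannot all be null. -/
theorem IsMarkovJumpProcess.exists_transition_pos (hX : IsMarkovJumpProcess X P)
    (hirr : Irreducible X P) (x y : E) : ∃ t, 0 < transition X P t x y := by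
  have := hX.isProbabilityMeasure x
  by_contra! hcon
  have hz : ∀ q : ℚ, P x {ω | X (Real.toNNReal q) ω = y} = 0 := fun q => by
    have := le_antisymm (hcon (Real.toNNReal q)) (transition_nonneg _ x y)
    exact (measureReal_eq_zero_iff).1 this
  refine (hirr x y).ne' (measure_mono_null ?_ (measure_iUnion_null hz))
  rintro ω ⟨t, ht⟩
  obtain ⟨ε, hε, h⟩ := hX.jump ω t
  obtain ⟨q, hq1, hq2⟩ := exists_rat_btwn (show (t : ℝ) < t + ε by
    have : (0 : ℝ) < ε := hε
    linarith)
  have hle : t ≤ Real.toNNReal q := by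
    rw [Real.le_toNNReal_iff_coe_le (t.2.trans hq1.le)]; exact hq1.le
  have h1 := h (Real.toNNReal q - t) (by
    rw [tsub_le_iff_left, Real.toNNReal_le_iff_le_coe]
    exact_mod_cast hq2.le)
  rw [add_tsub_cancel_of_le hle, ht] at h1
  exact Set.mem_iUnion.2 ⟨q, h1⟩

variable [Fintype E]

theorem IsMarkovJumpProcess.invariant_pos (hX : IsMarkovJumpProcess X P)
    (hirr : Irreducible X P) {π : E → ℝ} (hπ : IsInvariant X P π) (y : E) : 0 < π y := by
  obtain ⟨x, hx⟩ : ∃ x, 0 < π x := by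
    by_contra! h
    have := Finset.sum_nonpos fun x (_ : x ∈ Finset.univ) => h x
    rw [hπ.1.2] at this
    linarith
  obtain ⟨t, ht⟩ := hX.exists_transition_pos hirr x y
  have e : ∑ x, π x * transition X P t x y = π y := congrFun (hπ.2 t) y
  rw [← e]
  exact Finset.sum_pos' (fun z _ => mul_nonneg (hπ.1.1 z) (transition_nonneg t z y))
    ⟨x, Finset.mem_univ x, mul_pos hx ht⟩

variable [DiscreteMeasurableSpace E]

theorem IsMarkovJumpProcess.integral_comp (hX : IsMarkovJumpProcess X P) (t : ℝ≥0) (g : E → ℝ)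
    (x : E) : ∫ ω, g (X t ω) ∂(P x) = ∑ y, transition X P t x y * g y := by
  have := hX.isProbabilityMeasure x
  have : IsProbabilityMeasure ((P x).map (X t)) :=
    Measure.isProbabilityMeasure_map (hX.measurable t).aemeasurable
  have hg : Measurable g := measurable_of_finite g
  rw [← integral_map (hX.measurable t).aemeasurable hg.aestronglyMeasurable,
    integral_fintype .of_finite]
  refine Finset.sum_congr rfl fun y _ => ?_
  rw [map_measureReal_apply (hX.measurable t) (measurableSet_singleton y), smul_eq_mul]
  rfl

theorem IsMarkovJumpProcess.semigroup_eq (hX : IsMarkovJumpProcess X P) (t : ℝ≥0) (g : E → ℝ) :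
    semigroup X P t g = (transition X P t).mulVec g :=
  funext fun x => hX.integral_comp t g x

/-- The expectation of the Markov property conditioned on X_t alone. Later arguments use the Markov
property only in this form. -/
theorem IsMarkovJumpProcess.integral_shift (hX : IsMarkovJumpProcess X P) (x : E) (t : ℝ≥0)
    {A : (ℝ≥0 → E) → ℝ} (hA : Measurable A) (hb : ∃ C : ℝ, ∀ w, |A w| ≤ C) :
    ∫ ω, A (fun s => X (t + s) ω) ∂(P x) =
      ∑ y, transition X P t x y * ∫ ω, A (fun s => X s ω) ∂(P y) := by
  have := hX.isProbabilityMeasure x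
  rw [← hX.integral_comp t (fun y => ∫ ω, A (fun s => X s ω) ∂(P y)) x,
    ← integral_condExp (hX.measurable t).comap_le]
  exact integral_congr_ae (hX.markov x t A hA hb).2

theorem IsMarkovJumpProcess.sum_transition (hX : IsMarkovJumpProcess X P) (t : ℝ≥0) (x : E) :
    ∑ y, transition X P t x y = 1 := by
  have := hX.isProbabilityMeasure x
  simpa using (hX.integral_comp t (fun _ => 1) x).symm

theorem IsMarkovJumpProcess.ae_start (hX : IsMarkovJumpProcess X P) (x : E) :
    ∀ᵐ ω ∂(P x), X 0 ω = x := by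
  have := hX.isProbabilityMeasure x
  exact (prob_compl_eq_zero_iff (hX.measurable 0 (measurableSet_singleton x))).2 (hX.start x)

theorem IsMarkovJumpProcess.transition_eq_integral [DecidableEq E] (hX : IsMarkovJumpProcess X P)
    (t : ℝ≥0) (x y : E) :
    transition X P t x y = ∫ ω, (Pi.single y 1 : E → ℝ) (X t ω) ∂(P x) := by
  rw [hX.integral_comp]
  simp [Pi.single_apply]

theorem IsMarkovJumpProcess.transition_zero [DecidableEq E] (hX : IsMarkovJumpProcess X P) :
    transition X P 0 = 1 := by
  ext x y
  have := hX.isProbabilityMeasure x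
  rw [hX.transition_eq_integral, integral_congr_ae (g := fun _ => (Pi.single y 1 : E → ℝ) x)]
  · simp [Matrix.one_apply, Pi.single_apply]
  · filter_upwards [hX.ae_start x] with ω h
    rw [h]

theorem IsMarkovJumpProcess.transition_add (hX : IsMarkovJumpProcess X P) (s t : ℝ≥0) :
    transition X P (s + t) = transition X P s * transition X P t := by
  classical
  ext x y
  rw [hX.transition_eq_integral, Matrix.mul_apply]
  have hm : Measurable fun w : ℝ≥0 → E => (Pi.single y 1 : E → ℝ) (w t) :=
    (measurable_of_finite _).comp (measurable_pi_apply t)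
  have := hX.integral_shift x s hm ⟨1, fun w => by
    by_cases h : w t = y <;> simp [h]⟩
  rw [this]
  simp [hX.transition_eq_integral t]

theorem IsMarkovJumpProcess.tendsto_transition_zero [DecidableEq E]
    (hX : IsMarkovJumpProcess X P) : Tendsto (transition X P) (𝓝 0) (𝓝 1) := by
  rw [← hX.transition_zero]
  refine tendsto_pi_nhds.2 fun x => tendsto_pi_nhds.2 fun y => ?_
  have := hX.isProbabilityMeasure x
  simp only [hX.transition_eq_integral]
  refine tendsto_integral_filter_of_dominated_convergence (fun _ => 1) ?_ ?_ (by simp) ?_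
  · exact .of_forall fun t =>
      ((measurable_of_finite _).comp (hX.measurable t)).aestronglyMeasurable
  · refine .of_forall fun t => .of_forall fun ω => ?_
    by_cases h : X t ω = y <;> simp [h]
  · refine .of_forall fun ω => ?_
    have h := hX.eventually_eq ω 0
    -- In `ℝ≥0` a right neighbourhood of 0 is a full neighbourhood, so right continuity suffices.
    rw [show Set.Ici (0 : ℝ≥0) = Set.univ from Set.eq_univ_of_forall fun _ => Set.mem_Ici.2 zero_le,
      nhdsWithin_univ] at h
    exact tendsto_const_nhds.congr' (h.mono fun s hs => by simp only [hs])

-- In the maximal row sum norm, stochastic matrices have norm at most 1, which is the bound the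
-- abstract semigroup lemma needs.
open scoped Matrix.Norms.Operator in
theorem IsMarkovJumpProcess.exists_hasDerivWithinAt (hX : IsMarkovJumpProcess X P) :
    ∃ Q : Matrix E E ℝ, HasDerivWithinAt (fun h : ℝ => transition X P h.toNNReal) Q
      (Set.Ici 0) 0 := by
  classical
  refine exists_hasDerivWithinAt_of_semigroup hX.transition_add hX.tendsto_transition_zero
    hX.transition_zero (C := 1) fun t => ?_
  rw [Matrix.linfty_opNorm_def]
  norm_cast
  refine Finset.sup_le fun x _ => ?_
  rw [← NNReal.coe_le_coe]
  push_cast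
  simp only [Real.norm_of_nonneg (transition_nonneg t x _)]
  exact (hX.sum_transition t x).le

open scoped Matrix.Norms.Operator in
theorem IsMarkovJumpProcess.hasDerivWithinAt_transition (hX : IsMarkovJumpProcess X P) (x y : E) :
    HasDerivWithinAt (fun h : ℝ => transition X P h.toNNReal x y) (qMatrix X P x y)
      (Set.Ici 0) 0 := by
  obtain ⟨Q, hQ⟩ := hX.exists_hasDerivWithinAt
  have h1 : HasDerivWithinAt (fun h : ℝ => transition X P h.toNNReal x y) (Q x y) (Set.Ici 0) 0 :=
    ((Matrix.entryLinearMap ℝ ℝ x y).toContinuousLinearMap.hasFDerivAt.comp_hasDerivWithinAt 0 hQ)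
  have h2 : qMatrix X P x y = Q x y := h1.derivWithin (uniqueDiffOn_Ici 0 0 (by simp))
  rwa [h2]

theorem IsMarkovJumpProcess.hasDerivWithinAt_semigroup (hX : IsMarkovJumpProcess X P) (g : E → ℝ)
    (x : E) : HasDerivWithinAt (fun h : ℝ => semigroup X P h.toNNReal g x) (generator X P g x)
      (Set.Ici 0) 0 := by
  simp only [hX.semigroup_eq]
  exact HasDerivWithinAt.fun_sum fun y _ => (hX.hasDerivWithinAt_transition x y).mul_const (g y)

theorem IsMarkovJumpProcess.semigroup_zero (hX : IsMarkovJumpProcess X P) (g : E → ℝ) :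
    semigroup X P 0 g = g := by
  classical
  rw [hX.semigroup_eq, hX.transition_zero, Matrix.one_mulVec]

theorem IsMarkovJumpProcess.tendsto_generator (hX : IsMarkovJumpProcess X P) (g : E → ℝ) (x : E) :
    Tendsto (fun h : ℝ => (semigroup X P h.toNNReal g x - g x) / h) (𝓝[>] 0)
      (𝓝 (generator X P g x)) := by
  have h := (hX.hasDerivWithinAt_semigroup g x).mono Set.Ioi_subset_Ici_self
  rw [hasDerivWithinAt_iff_tendsto_slope' (by simp)] at h
  refine h.congr fun s => ?_
  rw [slope_def_field, Real.toNNReal_zero, hX.semigroup_zero, sub_zero]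

theorem IsMarkovJumpProcess.qMatrix_nonneg (hX : IsMarkovJumpProcess X P) {x y : E} (hxy : x ≠ y) :
    0 ≤ qMatrix X P x y := by
  classical
  have h := (hX.hasDerivWithinAt_transition x y).mono Set.Ioi_subset_Ici_self
  rw [hasDerivWithinAt_iff_tendsto_slope' (by simp)] at h
  refine ge_of_tendsto h (eventually_mem_nhdsWithin.mono fun s hs => ?_)
  rw [slope_def_field, Real.toNNReal_zero, hX.transition_zero, Matrix.one_apply_ne hxy, sub_zero,
    sub_zero]
  exact div_nonneg (transition_nonneg _ x y) (le_of_lt hs)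

theorem IsMarkovJumpProcess.sum_qMatrix (hX : IsMarkovJumpProcess X P) (x : E) :
    ∑ y, qMatrix X P x y = 0 := by
  have h : HasDerivWithinAt (fun h : ℝ => ∑ y, transition X P h.toNNReal x y)
      (∑ y, qMatrix X P x y) (Set.Ici 0) 0 :=
    HasDerivWithinAt.fun_sum fun y _ => hX.hasDerivWithinAt_transition x y
  simp only [hX.sum_transition] at h
  exact (uniqueDiffOn_Ici (0 : ℝ) 0 (by simp)).eq_deriv _ h (hasDerivWithinAt_const _ _ _)

theorem IsMarkovJumpProcess.vecMul_qMatrix (hX : IsMarkovJumpProcess X P) {π : E → ℝ}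
    (hπ : IsInvariant X P π) (y : E) : ∑ x, π x * qMatrix X P x y = 0 := by
  have h : HasDerivWithinAt (fun h : ℝ => ∑ x, π x * transition X P h.toNNReal x y)
      (∑ x, π x * qMatrix X P x y) (Set.Ici 0) 0 :=
    HasDerivWithinAt.fun_sum fun x _ => (hX.hasDerivWithinAt_transition x y).const_mul (π x)
  have e : ∀ t, ∑ x, π x * transition X P t x y = π y := fun t => congrFun (hπ.2 t) y
  simp only [e] at h
  exact (uniqueDiffOn_Ici (0 : ℝ) 0 (by simp)).eq_deriv _ h (hasDerivWithinAt_const _ _ _)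

/-! ### The weighted inner product and Rayleigh quotients. -/

section InnerL2

variable {E : Type*} [Fintype E] (π : E → ℝ)

theorem innerL2_comm (g h : E → ℝ) : innerL2 π g h = innerL2 π h g := by
  simp only [innerL2, mul_comm (g _)]

theorem innerL2_add_left (g g' h : E → ℝ) :
    innerL2 π (g + g') h = innerL2 π g h + innerL2 π g' h := by
  simp only [innerL2, Pi.add_apply, add_mul, Finset.sum_add_distrib]

theorem innerL2_smul_left (c : ℝ) (g h : E → ℝ) : innerL2 π (c • g) h = c * innerL2 π g h := by
  simp only [innerL2, Pi.smul_apply, smul_eq_mul, mul_assoc, Finset.mul_sum]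

theorem innerL2_add_right (g h h' : E → ℝ) :
    innerL2 π g (h + h') = innerL2 π g h + innerL2 π g h' := by
  rw [innerL2_comm, innerL2_add_left, innerL2_comm, innerL2_comm π h']

theorem innerL2_smul_right (c : ℝ) (g h : E → ℝ) : innerL2 π g (c • h) = c * innerL2 π g h := by
  rw [innerL2_comm, innerL2_smul_left, innerL2_comm]

theorem continuous_innerL2 {Y : Type*} [TopologicalSpace Y] {g h : Y → E → ℝ}
    (hg : Continuous g) (hh : Continuous h) : Continuous fun y => innerL2 π (g y) (h y) := by
  unfold innerL2
  fun_prop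

variable {π}

theorem innerL2_self_nonneg (hπ : ∀ x, 0 ≤ π x) (g : E → ℝ) : 0 ≤ innerL2 π g g :=
  Finset.sum_nonneg fun x _ => mul_nonneg (mul_self_nonneg _) (hπ x)

theorem innerL2_self_pos (hπ : ∀ x, 0 < π x) {g : E → ℝ} (hg : g ≠ 0) : 0 < innerL2 π g g := by
  obtain ⟨x, hx⟩ := Function.ne_iff.1 hg
  exact Finset.sum_pos' (fun x _ => mul_nonneg (mul_self_nonneg _) (hπ x).le)
    ⟨x, Finset.mem_univ x, mul_pos (mul_self_pos.2 hx) (hπ x)⟩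

theorem normL2_eq_one_iff {g : E → ℝ} : normL2 π g = 1 ↔ innerL2 π g g = 1 := by
  rw [normL2, Real.sqrt_eq_one]

theorem innerL2_le_normL2_mul (hπ : ∀ x, 0 ≤ π x) (g h : E → ℝ) :
    innerL2 π g h ≤ normL2 π g * normL2 π h := by
  have := Real.sum_mul_le_sqrt_mul_sqrt Finset.univ (fun x => g x * √(π x)) (fun x => h x * √(π x))
  convert this using 2
  · refine Finset.sum_congr rfl fun x _ => ?_
    linear_combination -(g x * h x) * (Real.mul_self_sqrt (hπ x))
  all_goals
    rw [normL2, innerL2]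
    congr 1
    refine Finset.sum_congr rfl fun x _ => ?_
    rw [mul_pow, Real.sq_sqrt (hπ x), sq]

/-- Cauchy–Schwarz with weights π and 1/π. It later turns entrywise errors of a matrix into an error
of its quadratic form in L²(π). -/
theorem sum_abs_sq_le_mul_innerL2 (hπ : ∀ x, 0 < π x) (g : E → ℝ) :
    (∑ x, |g x|) ^ 2 ≤ (∑ x, 1 / π x) * innerL2 π g g := by
  have h := Finset.sum_mul_sq_le_sq_mul_sq Finset.univ (fun x => 1 / √(π x))
    (fun x => |g x| * √(π x))
  have e1 : ∀ x, 1 / √(π x) * (|g x| * √(π x)) = |g x| := fun x => by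
    have := Real.sqrt_pos.2 (hπ x)
    field_simp
  have e2 : ∀ x, (1 / √(π x)) ^ 2 = 1 / π x := fun x => by
    rw [div_pow, one_pow, Real.sq_sqrt (hπ x).le]
  have e3 : ∀ x, (|g x| * √(π x)) ^ 2 = g x * g x * π x := fun x => by
    rw [mul_pow, Real.sq_sqrt (hπ x).le, sq_abs, sq]
  simp only [e1, e2, e3] at h
  exact h

theorem isCompact_sphereL2 (hπ : ∀ x, 0 < π x) : IsCompact {g : E → ℝ | innerL2 π g g = 1} := by
  refine Metric.isCompact_of_isClosed_isBounded
    (isClosed_eq (continuous_innerL2 π continuous_id continuous_id) continuous_const) ?_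
  refine (isCompact_univ_pi fun x =>
    isCompact_Icc (a := -√(1 / π x)) (b := √(1 / π x))).isBounded.subset fun g hg x _ => ?_
  rw [Set.mem_Icc, ← abs_le]
  refine Real.abs_le_sqrt ?_
  rw [le_div_iff₀ (hπ x), sq]
  exact (Finset.single_le_sum (f := fun x => g x * g x * π x)
    (fun x _ => mul_nonneg (mul_self_nonneg _) (hπ x).le) (Finset.mem_univ x)).trans_eq hg

theorem exists_smul_innerL2_eq_one (hπ : ∀ x, 0 < π x) {g : E → ℝ} (hg : g ≠ 0) :
    ∃ c : ℝ, c * c * innerL2 π g g = 1 := by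
  have h := innerL2_self_pos hπ hg
  refine ⟨1 / √(innerL2 π g g), ?_⟩
  rw [div_mul_div_comm, Real.mul_self_sqrt h.le]
  field_simp

/-- The Rayleigh quotient of a symmetric operator attains its maximum at an eigenvector. -/
theorem exists_max_rayleigh [Nonempty E] (hπ : ∀ x, 0 < π x) {T : (E → ℝ) →ₗ[ℝ] (E → ℝ)}
    (hT : ∀ g h, innerL2 π (T g) h = innerL2 π g (T h)) :
    ∃ μ : ℝ, ∃ g : E → ℝ, innerL2 π g g = 1 ∧ T g = μ • g ∧
      ∀ h, innerL2 π (T h) h ≤ μ * innerL2 π h h := by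
  have hne : {g : E → ℝ | innerL2 π g g = 1}.Nonempty := by
    obtain ⟨c, hc⟩ := exists_smul_innerL2_eq_one hπ (one_ne_zero (α := E → ℝ))
    exact ⟨c • 1, by
      rw [Set.mem_ofPred_eq, innerL2_smul_left, innerL2_smul_right, ← mul_assoc, hc]⟩
  have hTc : Continuous T := T.continuous_of_finiteDimensional
  obtain ⟨g, hg, hmax⟩ := (isCompact_sphereL2 hπ).exists_isMaxOn hne
    (continuous_innerL2 π hTc continuous_id).continuousOn
  rw [Set.mem_ofPred_eq] at hg
  set μ := innerL2 π (T g) g with hμ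
  have hle : ∀ h, innerL2 π (T h) h ≤ μ * innerL2 π h h := by
    intro h
    rcases eq_or_ne h 0 with rfl | h0
    · simp [innerL2]
    obtain ⟨c, hc⟩ := exists_smul_innerL2_eq_one hπ h0
    have hm : innerL2 π (c • h) (c • h) = 1 := by
      rw [innerL2_smul_left, innerL2_smul_right, ← mul_assoc, hc]
    have h1 : innerL2 π (T (c • h)) (c • h) ≤ μ := hmax hm
    rw [map_smul, innerL2_smul_left, innerL2_smul_right, ← mul_assoc] at h1
    have h2 := mul_le_mul_of_nonneg_right h1 (innerL2_self_pos hπ h0).le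
    calc innerL2 π (T h) h = c * c * innerL2 π (T h) h * innerL2 π h h := by
          linear_combination -(innerL2 π (T h) h) * hc
      _ ≤ _ := h2
  refine ⟨μ, g, hg, ?_, hle⟩
  -- Perturb the maximiser g along its residual k. The resulting quadratic in ε is nonnegative with
  -- zero constant term, so its linear coefficient 2⟨k,k⟩ vanishes.
  set k := μ • g + (-1 : ℝ) • T g with hk
  have hquad : ∀ ε : ℝ, 0 ≤ (μ * innerL2 π k k - innerL2 π (T k) k) * (ε * ε) +
      (2 * innerL2 π k k) * ε + 0 := by
    intro ε
    have h := hle (g + ε • k)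
    simp only [map_add, map_smul, innerL2_add_left, innerL2_add_right, innerL2_smul_left,
      innerL2_smul_right] at h
    have e1 : innerL2 π (T k) g = innerL2 π (T g) k := by rw [hT, innerL2_comm]
    have e2 : innerL2 π k k = μ * innerL2 π g k - innerL2 π (T g) k := by
      conv_lhs => rw [hk, innerL2_add_left, innerL2_smul_left, innerL2_smul_left]
      ring
    rw [innerL2_comm π k g, e1, hg, ← hμ] at h
    linear_combination h - 2 * ε * e2
  have hd := discrim_le_zero hquad
  rw [discrim] at hd
  have hk0 : k = 0 := by
    by_contra h0
    have := innerL2_self_pos hπ h0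
    nlinarith
  rw [hk] at hk0
  ext x
  have := congrFun hk0 x
  simp at this ⊢
  linarith

theorem isGreatest_eigenvalues_of_rayleigh (hπ : ∀ x, 0 < π x) {T : (E → ℝ) →ₗ[ℝ] (E → ℝ)}
    {μ : ℝ} {g : E → ℝ} (hg : innerL2 π g g = 1) (hTg : T g = μ • g)
    (hle : ∀ h, innerL2 π (T h) h ≤ μ * innerL2 π h h) : IsGreatest (eigenvalues T) μ := by
  refine ⟨Module.End.hasEigenvalue_of_hasEigenvector (x := g)
    ⟨Module.End.mem_eigenspace_iff.2 hTg, ?_⟩, fun c hc => ?_⟩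
  · rintro rfl
    simp [innerL2] at hg
  · obtain ⟨h, hh⟩ := Module.End.HasEigenvalue.exists_hasEigenvector hc
    have h1 := hle h
    rw [hh.apply_eq_smul, innerL2_smul_left] at h1
    exact le_of_mul_le_mul_right h1 (innerL2_self_pos hπ hh.2)

end InnerL2

/-! ### Dirichlet form, convexity and Lagrangian duality. -/

section DirichletForm

variable {E : Type*} [Fintype E] {π : E → ℝ} {Q : Matrix E E ℝ}

theorem innerL2_mulVecLin (π : E → ℝ) (Q : Matrix E E ℝ) (g h : E → ℝ) :
    innerL2 π (Q.mulVecLin g) h = ∑ x, ∑ y, π x * Q x y * (h x * g y) := by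
  simp only [innerL2, Matrix.mulVecLin_apply, Matrix.mulVec, dotProduct, Finset.sum_mul]
  exact Finset.sum_congr rfl fun x _ => Finset.sum_congr rfl fun y _ => by ring

theorem innerL2_mulLeft (π f g h : E → ℝ) :
    innerL2 π (LinearMap.mulLeft ℝ f g) h = ∑ x, f x * π x * (g x * h x) := by
  simp only [innerL2, LinearMap.mulLeft_apply, Pi.mul_apply]
  exact Finset.sum_congr rfl fun x _ => by ring

/-- Expanding the square, zero row sums and stationarity give ∑ π_x Q_xy (g_x − g_y)² = −2⟨Qg,g⟩,
and diagonal terms on the left vanish. -/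
theorem innerL2_mulVecLin_self_nonpos (hπ : ∀ x, 0 ≤ π x) (hQ : ∀ x y, x ≠ y → 0 ≤ Q x y)
    (hrow : ∀ x, ∑ y, Q x y = 0) (hcol : ∀ y, ∑ x, π x * Q x y = 0) (g : E → ℝ) :
    innerL2 π (Q.mulVecLin g) g ≤ 0 := by
  have h1 : 0 ≤ ∑ x, ∑ y, π x * Q x y * (g x - g y) ^ 2 := by
    refine Finset.sum_nonneg fun x _ => Finset.sum_nonneg fun y _ => ?_
    rcases eq_or_ne x y with rfl | hxy
    · simp
    · exact mul_nonneg (mul_nonneg (hπ x) (hQ x y hxy)) (sq_nonneg _)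
  have h2 : ∑ x, ∑ y, π x * Q x y * (g x - g y) ^ 2 =
      ∑ x, π x * g x ^ 2 * ∑ y, Q x y + ∑ y, g y ^ 2 * ∑ x, π x * Q x y
        - 2 * ∑ x, ∑ y, π x * Q x y * (g x * g y) := by
    simp only [Finset.mul_sum]
    rw [Finset.sum_comm (f := fun y x => g y ^ 2 * (π x * Q x y))]
    simp only [← Finset.sum_add_distrib, ← Finset.sum_sub_distrib]
    exact Finset.sum_congr rfl fun x _ => Finset.sum_congr rfl fun y _ => by ring
  simp only [hrow, hcol, mul_zero, Finset.sum_const_zero, zero_add, zero_sub] at h2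
  rw [innerL2_mulVecLin]
  linarith

theorem innerL2_mulVecLin_one (hrow : ∀ x, ∑ y, Q x y = 0) (h : E → ℝ) :
    innerL2 π (Q.mulVecLin 1) h = 0 := by
  have : Q.mulVecLin 1 = 0 := funext fun x => by simpa [Matrix.mulVec, dotProduct] using hrow x
  simp [this, innerL2]

/-- Cauchy–Schwarz in the plane; the defect of the squares is ab(ps − qr)². -/
theorem mul_add_mul_le_sqrt_mul_sqrt {a b : ℝ} (ha : 0 ≤ a) (hb : 0 ≤ b) (p q r s : ℝ) :
    a * (p * q) + b * (r * s) ≤ √(a * p ^ 2 + b * r ^ 2) * √(a * q ^ 2 + b * s ^ 2) := by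
  rw [← Real.sqrt_mul (by positivity)]
  refine (le_abs_self _).trans (Real.abs_le_sqrt ?_)
  nlinarith [mul_nonneg (mul_nonneg ha hb) (sq_nonneg (p * s - q * r))]

/-- The set of pairs `(⟨M_f g, g⟩, s)` with `‖g‖₂ = 1` and `s ≥ -⟨L g, g⟩`. -/
def energySet (π f : E → ℝ) (Q : Matrix E E ℝ) : Set (ℝ × ℝ) :=
  {z | ∃ g : E → ℝ, innerL2 π g g = 1 ∧ innerL2 π (LinearMap.mulLeft ℝ f g) g = z.1 ∧
    -innerL2 π (Q.mulVecLin g) g ≤ z.2}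

/-- The witness √(a g₁² + b g₂²) makes norm and constraint exactly affine, and the energy is convex
along it. -/
theorem convex_energySet (f : E → ℝ) (hπ : ∀ x, 0 ≤ π x) (hQ : ∀ x y, x ≠ y → 0 ≤ Q x y) :
    Convex ℝ (energySet π f Q) := by
  rintro ⟨m₁, s₁⟩ ⟨g₁, hg₁, hm₁, hs₁⟩ ⟨m₂, s₂⟩ ⟨g₂, hg₂, hm₂, hs₂⟩ a b ha hb hab
  have hsq : ∀ x, √(a * g₁ x ^ 2 + b * g₂ x ^ 2) * √(a * g₁ x ^ 2 + b * g₂ x ^ 2) =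
      a * g₁ x ^ 2 + b * g₂ x ^ 2 := fun x => Real.mul_self_sqrt (by positivity)
  refine ⟨fun x => √(a * g₁ x ^ 2 + b * g₂ x ^ 2), ?_, ?_, ?_⟩
  · have : a * innerL2 π g₁ g₁ + b * innerL2 π g₂ g₂ = 1 := by rw [hg₁, hg₂]; simpa using hab
    rw [← this]
    simp only [innerL2, hsq, Finset.mul_sum, ← Finset.sum_add_distrib]
    exact Finset.sum_congr rfl fun x _ => by ring
  · change _ = a * m₁ + b * m₂
    dsimp only at hm₁ hm₂
    rw [← hm₁, ← hm₂]
    simp only [innerL2_mulLeft, hsq, Finset.mul_sum, ← Finset.sum_add_distrib]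
    exact Finset.sum_congr rfl fun x _ => by ring
  · have h : a * innerL2 π (Q.mulVecLin g₁) g₁ + b * innerL2 π (Q.mulVecLin g₂) g₂ ≤
        innerL2 π (Q.mulVecLin fun x => √(a * g₁ x ^ 2 + b * g₂ x ^ 2))
          fun x => √(a * g₁ x ^ 2 + b * g₂ x ^ 2) := by
      simp only [innerL2_mulVecLin, Finset.mul_sum, ← Finset.sum_add_distrib]
      refine Finset.sum_le_sum fun x _ => Finset.sum_le_sum fun y _ => ?_
      -- Diagonal entries may be negative, but their terms involve only squares and give equality.
      rcases eq_or_ne x y with rfl | hxy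
      · rw [hsq]
        exact le_of_eq (by ring)
      · have := mul_le_mul_of_nonneg_left
          (mul_add_mul_le_sqrt_mul_sqrt ha hb (g₁ x) (g₁ y) (g₂ x) (g₂ y))
          (mul_nonneg (hπ x) (hQ x y hxy))
        linarith
    have h1 := mul_le_mul_of_nonneg_left hs₁ ha
    have h2 := mul_le_mul_of_nonneg_left hs₂ hb
    simp only [Prod.smul_mk, Prod.mk_add_mk, smul_eq_mul] at h1 h2 ⊢
    linarith

-- A sum of a compact set, the image of the unit sphere, and a closed vertical half-line.
open scoped Pointwise in
theorem isClosed_energySet (f : E → ℝ) (hπ : ∀ x, 0 < π x) (Q : Matrix E E ℝ) :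
    IsClosed (energySet π f Q) := by
  set φ : (E → ℝ) → ℝ × ℝ := fun g =>
    (innerL2 π (LinearMap.mulLeft ℝ f g) g, -innerL2 π (Q.mulVecLin g) g)
  have hφ : Continuous φ :=
    (continuous_innerL2 π (LinearMap.continuous_of_finiteDimensional _) continuous_id).prodMk
      (continuous_innerL2 π (LinearMap.continuous_of_finiteDimensional _) continuous_id).neg
  have hc := (isCompact_sphereL2 hπ).image hφ
  have hs : IsClosed (({0} : Set ℝ) ×ˢ Set.Ici (0 : ℝ)) := isClosed_singleton.prod isClosed_Ici
  have e : energySet π f Q =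
      φ '' {g | innerL2 π g g = 1} + ({0} : Set ℝ) ×ˢ Set.Ici (0 : ℝ) := by
    ext ⟨m, s⟩
    rw [Set.mem_add]
    constructor
    · rintro ⟨g, hg, hm, hs⟩
      refine ⟨φ g, ⟨g, hg, rfl⟩, (0, s - (φ g).2), ⟨rfl, sub_nonneg.2 hs⟩, ?_⟩
      ext
      · simpa [φ] using hm
      · simp
    · rintro ⟨_, ⟨g, hg, rfl⟩, ⟨z, w⟩, ⟨hz, hw⟩, h⟩
      rw [Prod.ext_iff] at h
      simp only [Set.mem_singleton_iff, Set.mem_Ici, Prod.fst_add, Prod.snd_add, φ] at h hz hw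
      exact ⟨g, hg, by linarith [h.1], by linarith [h.2]⟩
  rw [e]
  exact hs.add_left_of_isCompact hc

/-- Strong duality: a strict lower bound for the constrained energy is a lower bound for the
Lagrangian at a suitable multiplier. -/
theorem exists_multiplier (f : E → ℝ) (hπ : ∀ x, 0 < π x) (hQ : ∀ x y, x ≠ y → 0 ≤ Q x y)
    (hneg : ∀ g, innerL2 π (Q.mulVecLin g) g ≤ 0) {g₀ : E → ℝ} (hg₀ : innerL2 π g₀ g₀ = 1)
    {u c : ℝ}
    (hc : ∀ g : E → ℝ, innerL2 π g g = 1 → innerL2 π (LinearMap.mulLeft ℝ f g) g = u →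
      c < -innerL2 π (Q.mulVecLin g) g) :
    ∃ r : ℝ, ∀ g : E → ℝ, innerL2 π g g = 1 →
      c ≤ r * u - (innerL2 π (Q.mulVecLin g) g + r * innerL2 π (LinearMap.mulLeft ℝ f g) g) := by
  have hnot : (u, c) ∉ energySet π f Q := fun ⟨g, hg, hm, hs⟩ => (hc g hg hm).not_ge hs
  obtain ⟨ℓ, v, hlt, hgt⟩ := geometric_hahn_banach_point_closed
    (convex_energySet f (fun x => (hπ x).le) hQ) (isClosed_energySet f hπ Q) hnot
  set α := ℓ (1, 0)
  set β := ℓ (0, 1)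
  have hℓ : ∀ m s : ℝ, ℓ (m, s) = m * α + s * β := fun m s => by
    have : ((m, s) : ℝ × ℝ) = m • (1, 0) + s • (0, 1) := by simp
    rw [this, map_add, map_smul, map_smul, smul_eq_mul, smul_eq_mul]
  have hgt' : ∀ g : E → ℝ, innerL2 π g g = 1 → ∀ d : ℝ, 0 ≤ d →
      v < innerL2 π (LinearMap.mulLeft ℝ f g) g * α + (-innerL2 π (Q.mulVecLin g) g + d) * β := by
    intro g hg d hd
    rw [← hℓ]
    exact hgt _ ⟨g, hg, rfl, by simpa using hd⟩
  rw [hℓ] at hlt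
  -- The set is unbounded upwards over the point given by g₀, so a normal with β < 0 would violate
  -- the separation.
  have hβ : 0 ≤ β := by
    by_contra! hβ
    set w := innerL2 π (LinearMap.mulLeft ℝ f g₀) g₀ * α + -innerL2 π (Q.mulVecLin g₀) g₀ * β
    have h := hgt' g₀ hg₀ (|w - v| / -β) (by have := neg_pos.2 hβ; positivity)
    have e : |w - v| / -β * β = -|w - v| := by field_simp [hβ.ne]
    rw [add_mul, e] at h
    linarith [le_abs_self (w - v)]
  rcases hβ.eq_or_lt with h0 | hpos
  -- Vertical hyperplane: u is strictly separated from all constraint values. The multiplier is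
  -- scaled so that r(u − ⟨fg,g⟩) ≥ |c|, and the energy is nonnegative. This covers an empty
  -- constraint set.
  · rw [← h0] at hlt hgt'
    simp only [mul_zero, add_zero] at hlt hgt'
    have hη : 0 < v - u * α := sub_pos.2 hlt
    refine ⟨-(|c| / (v - u * α)) * α, fun g hg => ?_⟩
    have h1 := hgt' g hg 0 le_rfl
    have h2 : |c| ≤ |c| / (v - u * α) *
        (innerL2 π (LinearMap.mulLeft ℝ f g) g * α - u * α) := by
      calc |c| = |c| / (v - u * α) * (v - u * α) := by field_simp
        _ ≤ _ := mul_le_mul_of_nonneg_left (by linarith) (by positivity)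
    linarith [le_abs_self c, hneg g]
  · refine ⟨-α / β, fun g hg => ?_⟩
    have h1 := hlt.trans (hgt' g hg 0 le_rfl)
    rw [← sub_nonneg]
    have e : -α / β * u - (innerL2 π (Q.mulVecLin g) g +
        -α / β * innerL2 π (LinearMap.mulLeft ℝ f g) g) - c =
        ((innerL2 π (LinearMap.mulLeft ℝ f g) g * α + (-innerL2 π (Q.mulVecLin g) g + 0) * β) -
          (u * α + c * β)) / β := by
      field_simp
      ring
    rw [e]
    exact div_nonneg (sub_nonneg.2 h1.le) hpos.le

end DirichletForm

/-! ### A discretised Feynman–Kac formula. -/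

section FeynmanKac

theorem abs_additive_le {E Ω : Type*} [Fintype E] (X : ℝ≥0 → Ω → E)
    (f : E → ℝ) {t : ℝ} (ht : 0 ≤ t) (ω : Ω) :
    |additive X f t ω| ≤ (∑ x, |f x|) * t := by
  have := intervalIntegral.norm_integral_le_of_norm_le_const (a := 0) (b := t)
    (f := fun s => f (X s.toNNReal ω)) (C := ∑ x, |f x|) fun s _ =>
      Finset.single_le_sum (f := fun x => |f x|) (fun _ _ => abs_nonneg _) (Finset.mem_univ _)
  rwa [sub_zero, abs_of_nonneg ht] at this

variable {E Ω : Type*} [MeasurableSpace Ω] {X : ℝ≥0 → Ω → E} {P : E → Measure Ω}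

/-- One step `g ↦ P_h(φ g)` of the discretised Feynman–Kac semigroup. -/
noncomputable def weightedStep (X : ℝ≥0 → Ω → E) (P : E → Measure Ω) (h : ℝ≥0) (φ g : E → ℝ) :
    E → ℝ :=
  semigroup X P h (φ * g)

variable [MeasurableSpace E] [Fintype E]

section

variable [DiscreteMeasurableSpace E]

/-- Induction on n by the Markov property at time h: the first factor φ(X_h) is the value at time 0
of the shifted path, and the remaining factors are the n-step product for that path. -/
theorem IsMarkovJumpProcess.integral_prod (hX : IsMarkovJumpProcess X P) (h : ℝ≥0) (φ : E → ℝ)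
    (n : ℕ) (x : E) :
    ∫ ω, ∏ k ∈ Finset.range n, φ (X ((k + 1 : ℕ) * h) ω) ∂(P x) =
      (weightedStep X P h φ)^[n] 1 x := by
  induction n generalizing x with
  | zero =>
    have := hX.isProbabilityMeasure x
    simp
  | succ n ih =>
    set A : (ℝ≥0 → E) → ℝ := fun w => φ (w 0) * ∏ k ∈ Finset.range n, φ (w ((k + 1 : ℕ) * h))
    have hφ : Measurable φ := measurable_of_finite φ
    have hA : Measurable A := (hφ.comp (measurable_pi_apply 0)).mul
      (Finset.measurable_prod _ fun k _ => hφ.comp (measurable_pi_apply _))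
    have hb : ∃ C : ℝ, ∀ w, |A w| ≤ C := by
      set M := ∑ x, |φ x|
      have hM : ∀ x, |φ x| ≤ M := fun x =>
        Finset.single_le_sum (f := fun x => |φ x|) (fun _ _ => abs_nonneg _) (Finset.mem_univ x)
      refine ⟨M * ∏ _k ∈ Finset.range n, M, fun w => ?_⟩
      rw [abs_mul, Finset.abs_prod]
      exact mul_le_mul (hM _) (Finset.prod_le_prod (fun _ _ => abs_nonneg _) fun _ _ => hM _)
        (Finset.prod_nonneg fun _ _ => abs_nonneg _) ((abs_nonneg _).trans (hM x))
    have e1 : ∀ ω, ∏ k ∈ Finset.range (n + 1), φ (X ((k + 1 : ℕ) * h) ω) =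
        A fun s => X (h + s) ω := by
      intro ω
      rw [Finset.prod_range_succ', mul_comm]
      simp only [A]
      congr 1
      · simp
      · refine Finset.prod_congr rfl fun k _ => ?_
        congr 2
        push_cast
        ring
    have e2 : ∀ y, ∫ ω, A (fun s => X s ω) ∂(P y) =
        φ y * (weightedStep X P h φ)^[n] 1 y := by
      intro y
      rw [← ih, ← integral_const_mul]
      refine integral_congr_ae ?_
      filter_upwards [hX.ae_start y] with ω hω
      simp only [A, hω]
    simp_rw [e1]
    rw [hX.integral_shift x h hA hb, Function.iterate_succ_apply', weightedStep, hX.semigroup_eq]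
    simp_rw [e2]
    rfl

end

/-- Right-endpoint Riemann sums along a right continuous path converge. -/
theorem IsMarkovJumpProcess.tendsto_riemannSum (hX : IsMarkovJumpProcess X P) (f : E → ℝ)
    {t : ℝ≥0} (ht : 0 < t) (ω : Ω) :
    Tendsto (fun n : ℕ => ∑ k ∈ Finset.range n, (t / n : ℝ) * f (X ((k + 1 : ℕ) * (t / n)) ω))
      atTop (𝓝 (additive X f t ω)) := by
  have ht' : (0 : ℝ) < t := ht
  -- The ceiling selects the right endpoint of the cell (kt/n, (k+1)t/n] containing s. These
  -- endpoints approach s from the right, so right continuity gives pointwise convergence.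
  set F : ℕ → ℝ → ℝ := fun n s => f (X ((⌈s * n / t⌉₊ : ℕ) * (t / n)) ω)
  have hFm : ∀ n, Measurable (F n) := fun n => by
    have h1 : Measurable fun s : ℝ => ⌈s * n / t⌉₊ := Nat.measurable_ceil.comp (by fun_prop)
    exact (measurable_from_nat (f := fun m : ℕ => f (X ((m : ℝ≥0) * (t / n)) ω))).comp h1
  set M := ∑ x, |f x|
  have hM : ∀ x, ‖f x‖ ≤ M := fun x =>
    Finset.single_le_sum (f := fun x => |f x|) (fun _ _ => abs_nonneg _) (Finset.mem_univ x)
  have hsum : ∀ n : ℕ, 0 < n → ∑ k ∈ Finset.range n, (t / n : ℝ) * f (X ((k + 1 : ℕ) * (t / n)) ω)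
      = ∫ s in (0 : ℝ)..t, F n s := by
    intro n hn
    have hn' : (0 : ℝ) < n := Nat.cast_pos.2 hn
    have hint : ∀ a b, IntervalIntegrable (F n) volume a b := fun a b =>
      (intervalIntegrable_const (c := M)).mono_fun (hFm n).aestronglyMeasurable
        (.of_forall fun s => (hM _).trans (le_abs_self M))
    have hadj := intervalIntegral.sum_integral_adjacent_intervals (f := F n) (μ := volume)
      (a := fun k : ℕ => (k : ℝ) * (t / n)) (n := n) fun k _ => hint _ _
    rw [Nat.cast_zero, zero_mul, mul_div_cancel₀ _ hn'.ne'] at hadj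
    rw [← hadj]
    refine Finset.sum_congr rfl fun k _ => ?_
    have hle : (k : ℝ) * (t / n) ≤ (k + 1 : ℕ) * (t / n) := by
      gcongr
      simp
    have hcongr : ∫ s in (k : ℝ) * (t / n)..(k + 1 : ℕ) * (t / n), F n s =
        ∫ s in (k : ℝ) * (t / n)..(k + 1 : ℕ) * (t / n), f (X ((k + 1 : ℕ) * (t / n)) ω) := by
      rw [intervalIntegral.integral_of_le hle, intervalIntegral.integral_of_le hle]
      refine setIntegral_congr_fun measurableSet_Ioc fun s hs => ?_
      have hc : ⌈s * n / t⌉₊ = k + 1 := by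
        rw [Nat.ceil_eq_iff (by omega), lt_div_iff₀ ht', div_le_iff₀ ht']
        have h1 := hs.1
        have h2 := hs.2
        rw [← mul_div_assoc, div_lt_iff₀ hn'] at h1
        rw [← mul_div_assoc, le_div_iff₀ hn'] at h2
        exact ⟨by simpa using h1, h2⟩
      simp only [F, hc]
    rw [hcongr, intervalIntegral.integral_const, smul_eq_mul]
    push_cast
    ring
  refine Tendsto.congr' ((eventually_gt_atTop 0).mono fun n hn => (hsum n hn).symm) ?_
  refine intervalIntegral.tendsto_integral_filter_of_dominated_convergence (fun _ => M)
    (.of_forall fun n => (hFm n).aestronglyMeasurable)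
    (.of_forall fun n => .of_forall fun s _ => hM _) intervalIntegrable_const
    (.of_forall fun s hs => ?_)
  rw [Set.uIoc_of_le ht'.le] at hs
  have hlim : Tendsto (fun n : ℕ => ((⌈s * n / t⌉₊ : ℕ) * (t / n) : ℝ≥0)) atTop
      (𝓝[≥] s.toNNReal) := by
    have hlow : ∀ n : ℕ, 0 < n → s ≤ (⌈s * n / t⌉₊ : ℕ) * (t / n : ℝ) := fun n hn => by
      have hn' : (0 : ℝ) < n := Nat.cast_pos.2 hn
      have := mul_le_mul_of_nonneg_right (Nat.le_ceil (s * n / t)) (div_pos ht' hn').le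
      rwa [show s * n / t * (t / n) = s by field_simp] at this
    have hupp : ∀ n : ℕ, 0 < n → (⌈s * n / t⌉₊ : ℕ) * (t / n : ℝ) ≤ s + t / n := fun n hn => by
      have hn' : (0 : ℝ) < n := Nat.cast_pos.2 hn
      have h0 : 0 ≤ s * n / t := div_nonneg (mul_nonneg hs.1.le hn'.le) ht'.le
      have := mul_le_mul_of_nonneg_right (Nat.ceil_lt_add_one h0).le (div_pos ht' hn').le
      rwa [add_mul, one_mul, show s * n / t * (t / n) = s by field_simp] at this
    refine tendsto_nhdsWithin_iff.2 ⟨?_, ?_⟩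
    · rw [← NNReal.tendsto_coe, Real.coe_toNNReal s hs.1.le]
      push_cast
      refine tendsto_of_tendsto_of_tendsto_of_le_of_le' tendsto_const_nhds ?_
        ((eventually_gt_atTop 0).mono hlow) ((eventually_gt_atTop 0).mono hupp)
      simpa using (tendsto_const_div_atTop_nhds_zero_nat (t : ℝ)).const_add s
    · filter_upwards [eventually_gt_atTop 0] with n hn
      rw [Set.mem_Ici, Real.toNNReal_le_iff_le_coe]
      push_cast
      exact hlow n hn
  have := hlim.eventually (hX.eventually_eq ω s.toNNReal)
  exact tendsto_const_nhds.congr' (this.mono fun n hn => by simp only [F, hn])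

variable [DiscreteMeasurableSpace E]

theorem IsMarkovJumpProcess.measurable_additive (hX : IsMarkovJumpProcess X P) (f : E → ℝ)
    {t : ℝ≥0} (ht : 0 < t) : Measurable (additive X f t) :=
  measurable_of_tendsto_metrizable
    (fun _ => Finset.measurable_sum _ fun _ _ =>
      ((measurable_of_finite f).comp (hX.measurable _)).const_mul _)
    (tendsto_pi_nhds.2 fun ω => hX.tendsto_riemannSum f ht ω)

/-- The product of the weights is the exponential of r times the Riemann sum, bounded by exp(|r|Mt)
with M = ∑|f|; dominated convergence applies. -/
theorem IsMarkovJumpProcess.tendsto_weightedStep (hX : IsMarkovJumpProcess X P) (f : E → ℝ)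
    {t : ℝ≥0} (ht : 0 < t) (r : ℝ) (x : E) :
    Tendsto (fun n : ℕ => (weightedStep X P (t / n)
        (fun y => Real.exp ((t / n : ℝ≥0) * (r * f y))))^[n] 1 x)
      atTop (𝓝 (ProbabilityTheory.mgf (additive X f t) (P x) r)) := by
  have := hX.isProbabilityMeasure x
  simp only [← hX.integral_prod, ← Real.exp_sum]
  have e : ∀ (n : ℕ) ω, ∑ k ∈ Finset.range n, (t / n : ℝ≥0) * (r * f (X ((k + 1 : ℕ) * (t / n)) ω))
      = r * ∑ k ∈ Finset.range n, (t / n : ℝ) * f (X ((k + 1 : ℕ) * (t / n)) ω) := fun n ω => by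
    rw [Finset.mul_sum]
    refine Finset.sum_congr rfl fun k _ => ?_
    push_cast
    ring
  simp only [e]
  set M := ∑ x, |f x|
  refine tendsto_integral_of_dominated_convergence (fun _ => Real.exp (|r| * (M * t)))
    (fun n => ?_) (integrable_const _) (fun n => .of_forall fun ω => ?_)
    (.of_forall fun ω => ?_)
  · exact (Real.measurable_exp.comp ((Finset.measurable_sum _ fun _ _ =>
      ((measurable_of_finite f).comp (hX.measurable _)).const_mul _).const_mul r)).aestronglyMeasurable
  · rw [Real.norm_eq_abs, Real.abs_exp, Real.exp_le_exp]
    refine (le_abs_self _).trans ?_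
    rw [abs_mul]
    refine mul_le_mul_of_nonneg_left ?_ (abs_nonneg r)
    refine (Finset.abs_sum_le_sum_abs _ _).trans ?_
    have hM : ∀ x, |f x| ≤ M := fun x =>
      Finset.single_le_sum (f := fun x => |f x|) (fun _ _ => abs_nonneg _) (Finset.mem_univ x)
    refine (Finset.sum_le_card_nsmul _ _ ((t / n : ℝ) * M) fun k _ => ?_).trans ?_
    · rw [abs_mul, abs_of_nonneg (by positivity)]
      exact mul_le_mul_of_nonneg_left (hM _) (by positivity)
    · rw [Finset.card_range, nsmul_eq_mul]
      rcases Nat.eq_zero_or_pos n with rfl | hn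
      · have : 0 ≤ M := Finset.sum_nonneg fun _ _ => abs_nonneg _
        simp only [CharP.cast_eq_zero, zero_mul]
        positivity
      · have hn' : (n : ℝ) ≠ 0 := by positivity
        exact le_of_eq (by field_simp)
  · exact (Real.continuous_exp.tendsto _).comp ((hX.tendsto_riemannSum f ht ω).const_mul r)

end FeynmanKac

/-! ### The top eigenvalue and its Fenchel conjugate. -/

section

variable {E Ω : Type*} [Fintype E] [MeasurableSpace Ω] (X : ℝ≥0 → Ω → E) (P : E → Measure Ω)

/-- ⟨L*g,g⟩ = ⟨Lg,g⟩, so symmetrisation is invisible to the quadratic form. -/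
theorem innerL2_tilted {π : E → ℝ} (hπ : ∀ x, 0 < π x) (f : E → ℝ) (r : ℝ) (g : E → ℝ) :
    innerL2 π (tilted X P π f r g) g =
      innerL2 π (generator X P g) g + r * innerL2 π (LinearMap.mulLeft ℝ f g) g := by
  simp only [tilted, LinearMap.add_apply, LinearMap.smul_apply, innerL2_add_left,
    innerL2_smul_left, generatorAdjoint, innerL2_adjointMatrix π hπ, generator]
  rw [innerL2_comm π g]
  ring

theorem innerL2_tilted_symm {π : E → ℝ} (hπ : ∀ x, 0 < π x) (f : E → ℝ) (r : ℝ) (g h : E → ℝ) :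
    innerL2 π (tilted X P π f r g) h = innerL2 π g (tilted X P π f r h) := by
  have e1 := innerL2_adjointMatrix π hπ (qMatrix X P) g h
  have e2 := innerL2_adjointMatrix π hπ (qMatrix X P) h g
  have e3 : innerL2 π (LinearMap.mulLeft ℝ f g) h = innerL2 π g (LinearMap.mulLeft ℝ f h) := by
    rw [innerL2_mulLeft, innerL2_comm, innerL2_mulLeft]
    exact Finset.sum_congr rfl fun x _ => by ring
  simp only [tilted, LinearMap.add_apply, LinearMap.smul_apply, innerL2_add_left,
    innerL2_smul_left, innerL2_add_right, innerL2_smul_right, generatorAdjoint, generator]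
  rw [e1, e3, innerL2_comm π g ((adjointMatrix π (qMatrix X P)).mulVecLin h), e2,
    innerL2_comm π h]
  ring

theorem topEigenvalue_spec [Nonempty E] {π : E → ℝ} (hπ : ∀ x, 0 < π x) (f : E → ℝ) (r : ℝ) :
    IsGreatest (eigenvalues (tilted X P π f r)) (topEigenvalue X P π f r) ∧
    (∃ g, innerL2 π g g = 1 ∧ innerL2 π (generator X P g) g +
      r * innerL2 π (LinearMap.mulLeft ℝ f g) g = topEigenvalue X P π f r) ∧
    ∀ g, innerL2 π (generator X P g) g + r * innerL2 π (LinearMap.mulLeft ℝ f g) g ≤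
      topEigenvalue X P π f r * innerL2 π g g := by
  obtain ⟨μ, g, hg, hTg, hle⟩ := exists_max_rayleigh hπ (innerL2_tilted_symm X P hπ f r)
  have hgr := isGreatest_eigenvalues_of_rayleigh hπ hg hTg hle
  have e : topEigenvalue X P π f r = μ := hgr.csSup_eq
  simp only [← innerL2_tilted X P hπ, e]
  exact ⟨hgr, ⟨g, hg, by rw [hTg, innerL2_smul_left, hg, mul_one]⟩, hle⟩

theorem fenchel_univ_eq_of_nonneg {F : ℝ → ℝ} (h0 : F 0 = 0) (hF : ∀ r, 0 ≤ F r) {u : ℝ}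
    (hu : 0 ≤ u) : fenchel Set.univ F u = fenchel (Set.Ici 0) F u := by
  refine le_antisymm (iSup₂_le fun r _ => ?_) (biSup_mono fun _ _ => Set.mem_univ _)
  rcases le_total 0 r with hr | hr
  · exact le_iSup₂ (f := fun r (_ : r ∈ Set.Ici (0 : ℝ)) => ((r * u - F r : ℝ) : EReal)) r hr
  · refine le_trans ?_ (le_iSup₂
      (f := fun r (_ : r ∈ Set.Ici (0 : ℝ)) => ((r * u - F r : ℝ) : EReal)) 0 (Set.mem_Ici.2 le_rfl))
    rw [EReal.coe_le_coe_iff, h0]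
    nlinarith [hF r, mul_nonneg (neg_nonneg.2 hr) hu]

end

/-- Optimisation over r. After taking logarithms each bound reads ru − F(r) ≤ −log(p/c)/t in
`EReal`, so the supremum obeys it too, including when it is infinite or p = 0. -/
theorem le_mul_exp_neg_mul_fenchel {D : Set ℝ} {F : ℝ → ℝ} {u t c : ℝ} {p : ℝ≥0∞} (ht : 0 < t)
    (hc : 0 < c)
    (h : ∀ r ∈ D, p ≤ ENNReal.ofReal c * ENNReal.ofReal (Real.exp (-(t * (r * u - F r))))) :
    p ≤ ENNReal.ofReal c * EReal.exp (-((t : EReal) * fenchel D F u)) := by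
  have hc0 : ENNReal.ofReal c ≠ 0 := by simpa using hc
  set q := p / ENNReal.ofReal c
  have hq : ∀ a, p ≤ ENNReal.ofReal c * a ↔ q ≤ a := fun a =>
    (ENNReal.div_le_iff' hc0 ENNReal.ofReal_ne_top).symm
  have ht' : (0 : EReal) < t := EReal.coe_pos.2 ht
  rw [hq, ← ENNReal.exp_log q, EReal.exp_le_exp_iff, EReal.le_neg, mul_comm,
    ← EReal.le_div_iff_mul_le ht' (EReal.coe_ne_top t)]
  refine iSup₂_le fun r hr => ?_
  have h1 := h r hr
  rw [hq, ← EReal.exp_coe, ← ENNReal.exp_log q, EReal.exp_le_exp_iff, EReal.coe_neg, EReal.le_neg,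
    mul_comm, EReal.coe_mul] at h1
  rwa [EReal.le_div_iff_mul_le ht' (EReal.coe_ne_top t)]

/-! ### The variational formula and the exponential moment bound. -/

section

variable {E Ω : Type*} [Fintype E] [MeasurableSpace E] [DiscreteMeasurableSpace E]
  [MeasurableSpace Ω] {X : ℝ≥0 → Ω → E} {P : E → Measure Ω} {π : E → ℝ}

theorem IsMarkovJumpProcess.fenchel_eq_rateFunction [Nonempty E] (hX : IsMarkovJumpProcess X P)
    (hπ : ∀ x, 0 < π x) (hinv : IsInvariant X P π) (f : E → ℝ) (u : ℝ) :
    fenchel Set.univ (topEigenvalue X P π f) u = rateFunction X P π f u := by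
  refine le_antisymm (iSup₂_le fun r _ => le_iInf₂ fun g hg => ?_) ?_
  · have h := (topEigenvalue_spec X P hπ f r).2.2 g
    rw [normL2_eq_one_iff.1 hg.1, hg.2] at h
    rw [EReal.coe_le_coe_iff]
    linarith
  · rw [← EReal.ge_of_forall_gt_iff_ge]
    intro c hc
    obtain ⟨g₀, hg₀, -⟩ := (topEigenvalue_spec X P hπ f 0).2.1
    obtain ⟨r, hr⟩ := exists_multiplier (Q := qMatrix X P) (u := u) (c := c) f hπ
      (fun x y => hX.qMatrix_nonneg)
      (innerL2_mulVecLin_self_nonpos (fun x => (hπ x).le) (fun x y => hX.qMatrix_nonneg)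
        hX.sum_qMatrix (hX.vecMul_qMatrix hinv)) hg₀ fun g hg hm => by
        have h1 : rateFunction X P π f u ≤ ((-innerL2 π (generator X P g) g : ℝ) : EReal) :=
          iInf₂_le g ⟨normL2_eq_one_iff.2 hg, hm⟩
        exact EReal.coe_lt_coe_iff.1 (hc.trans_le h1)
    -- Evaluated at a maximiser of the Rayleigh quotient, the Lagrangian is ru − λ₀(r).
    obtain ⟨g, hg, he⟩ := (topEigenvalue_spec X P hπ f r).2.1
    have h2 := hr g hg
    change c ≤ r * u - (innerL2 π (generator X P g) g + _) at h2
    rw [he] at h2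
    exact (EReal.coe_le_coe_iff.2 h2).trans (le_iSup₂ (f := fun r (_ : r ∈ Set.univ) =>
      ((r * u - topEigenvalue X P π f r : ℝ) : EReal)) r (Set.mem_univ r))

theorem IsMarkovJumpProcess.topEigenvalue_zero [Nonempty E] (hX : IsMarkovJumpProcess X P)
    (hπ : ∀ x, 0 < π x) (hinv : IsInvariant X P π) (f : E → ℝ) :
    topEigenvalue X P π f 0 = 0 := by
  obtain ⟨-, ⟨g, -, he⟩, hle⟩ := topEigenvalue_spec X P hπ f 0
  refine le_antisymm ?_ ?_
  · rw [← he, zero_mul, add_zero]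
    exact innerL2_mulVecLin_self_nonpos (fun x => (hπ x).le) (fun x y => hX.qMatrix_nonneg)
        hX.sum_qMatrix (hX.vecMul_qMatrix hinv) g
  · have h := hle 1
    rw [generator, innerL2_mulVecLin_one hX.sum_qMatrix, zero_mul, add_zero] at h
    exact nonneg_of_mul_nonneg_left h (innerL2_self_pos hπ one_ne_zero)

/-- Test with the constant function 1: L1 = 0 and π(f) = 0. -/
theorem IsMarkovJumpProcess.topEigenvalue_nonneg [Nonempty E] (hX : IsMarkovJumpProcess X P)
    (hπ : ∀ x, 0 < π x) {f : E → ℝ} (hf : ∑ x, f x * π x = 0) (r : ℝ) :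
    0 ≤ topEigenvalue X P π f r := by
  have h := (topEigenvalue_spec X P hπ f r).2.2 1
  rw [generator, innerL2_mulVecLin_one hX.sum_qMatrix, innerL2_mulLeft] at h
  simp only [Pi.one_apply, mul_one, hf, mul_zero, add_zero] at h
  exact nonneg_of_mul_nonneg_left h (innerL2_self_pos hπ one_ne_zero)

theorem IsMarkovJumpProcess.weightedStep_apply (hX : IsMarkovJumpProcess X P) (h : ℝ≥0)
    (φ g : E → ℝ) (x : E) :
    weightedStep X P h φ g x = ∑ y, transition X P h x y * φ y * g y := by
  rw [weightedStep, hX.semigroup_eq]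
  simp only [Matrix.mulVec, dotProduct, Pi.mul_apply, mul_assoc]

/-- Short-time growth of the weighted steps in `L²(π)`. -/
theorem IsMarkovJumpProcess.eventually_weightedStep_le [Nonempty E] (hX : IsMarkovJumpProcess X P)
    (hπ : ∀ x, 0 < π x) (f : E → ℝ) (r : ℝ) {ε : ℝ} (hε : 0 < ε) :
    ∀ᶠ h : ℝ in 𝓝[>] 0, ∀ g : E → ℝ,
      innerL2 π (weightedStep X P h.toNNReal (fun y => Real.exp (h * (r * f y))) g)
        (weightedStep X P h.toNNReal (fun y => Real.exp (h * (r * f y))) g) ≤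
      Real.exp (h * (2 * topEigenvalue X P π f r + ε)) * innerL2 π g g := by
  classical
  set μ := topEigenvalue X P π f r
  -- `k h` is the kernel of the weighted step, and `G`, the matrix of L + rM_f, is its right
  -- derivative at 0.
  set k : ℝ → E → E → ℝ := fun h x y => transition X P h.toNNReal x y * Real.exp (h * (r * f y))
  set G : E → E → ℝ := fun x y => qMatrix X P x y + (1 : Matrix E E ℝ) x y * (r * f y)
  have hk0 : ∀ x y, k 0 x y = (1 : Matrix E E ℝ) x y := fun x y => by
    simp [k, hX.transition_zero]
  have hk : ∀ x y, HasDerivWithinAt (fun h => k h x y) (G x y) (Set.Ioi 0) 0 := fun x y => by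
    have h1 := (hX.hasDerivWithinAt_transition x y).mono Set.Ioi_subset_Ici_self
    have h2 : HasDerivAt (fun h : ℝ => Real.exp (h * (r * f y))) (r * f y) 0 := by
      simpa using ((hasDerivAt_id (0 : ℝ)).mul_const (r * f y)).exp
    have h3 := h1.mul h2.hasDerivWithinAt
    simp only [Real.toNNReal_zero, hX.transition_zero, zero_mul, Real.exp_zero, mul_one] at h3
    exact h3
  -- `M h` is the matrix of the form g ↦ ‖W_h g‖²; the form of its derivative `M'` is 2(⟨Lg,g⟩ +
  -- r⟨fg,g⟩).
  set M : ℝ → E → E → ℝ := fun h y z => ∑ x, π x * (k h x y * k h x z)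
  set M' : E → E → ℝ := fun y z =>
    ∑ x, π x * (G x y * (1 : Matrix E E ℝ) x z + (1 : Matrix E E ℝ) x y * G x z)
  have hM : ∀ y z, HasDerivWithinAt (fun h => M h y z) (M' y z) (Set.Ioi 0) 0 := fun y z => by
    refine HasDerivWithinAt.fun_sum fun x _ => HasDerivWithinAt.const_mul _ ?_
    have := (hk x y).mul (hk x z)
    rwa [hk0, hk0] at this
  have hM0 : ∀ g : E → ℝ, ∑ y, ∑ z, M 0 y z * (g y * g z) = innerL2 π g g := fun g => by
    simp only [M, hk0, innerL2, Matrix.one_apply]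
    simp
    exact Finset.sum_congr rfl fun x _ => by ring
  have hM1 : ∀ g : E → ℝ, ∑ y, ∑ z, M' y z * (g y * g z) =
      2 * (innerL2 π (generator X P g) g + r * innerL2 π (LinearMap.mulLeft ℝ f g) g) := fun g => by
    have e1 : ∀ y z, M' y z = π z * G z y + π y * G y z := fun y z => by
      simp only [M', mul_add, Finset.sum_add_distrib, Matrix.one_apply]
      simp
    have e2 : ∑ y, ∑ z, π y * G y z * (g y * g z) =
        innerL2 π (generator X P g) g + r * innerL2 π (LinearMap.mulLeft ℝ f g) g := by
      simp only [G, mul_add, add_mul, Finset.sum_add_distrib]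
      rw [generator, innerL2_mulVecLin, innerL2_mulLeft, Finset.mul_sum]
      congr 1
      refine Finset.sum_congr rfl fun x _ => ?_
      rw [Finset.sum_eq_single x (fun z _ hz => by simp [Matrix.one_apply_ne hz.symm]) (by simp)]
      simp
      ring
    simp only [e1, add_mul, Finset.sum_add_distrib]
    rw [Finset.sum_comm, two_mul, ← e2]
    congr 1
    exact Finset.sum_congr rfl fun x _ => Finset.sum_congr rfl fun y _ => by ring
  have hnorm : ∀ (h : ℝ) (g : E → ℝ),
      innerL2 π (weightedStep X P h.toNNReal (fun y => Real.exp (h * (r * f y))) g)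
        (weightedStep X P h.toNNReal (fun y => Real.exp (h * (r * f y))) g) =
      ∑ y, ∑ z, M h y z * (g y * g z) := fun h g => by
    simp only [innerL2, hX.weightedStep_apply, Finset.sum_mul_sum]
    simp only [M, Finset.sum_mul]
    rw [Finset.sum_comm]
    refine Finset.sum_congr rfl fun y _ => ?_
    rw [Finset.sum_comm]
    exact Finset.sum_congr rfl fun z _ => Finset.sum_congr rfl fun x _ => by ring
  set K := ∑ x, 1 / π x
  have hK : 0 < K := Finset.sum_pos (fun x _ => one_div_pos.2 (hπ x)) Finset.univ_nonempty
  -- There are finitely many entries, so one range of h serves them all, and hence all g. The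
  -- tolerance ε/K becomes ε‖g‖² after `sum_abs_sq_le_mul_innerL2`.
  have hev : ∀ᶠ h : ℝ in 𝓝[>] 0, ∀ y z, |slope (fun h => M h y z) 0 h - M' y z| ≤ ε / K := by
    refine eventually_all.2 fun y => eventually_all.2 fun z => ?_
    have h1 := hM y z
    rw [hasDerivWithinAt_iff_tendsto_slope' (by simp)] at h1
    have h2 := h1 (Metric.closedBall_mem_nhds _ (div_pos hε hK))
    exact h2
  filter_upwards [hev, self_mem_nhdsWithin] with h hh hpos g
  have hpos' : 0 < h := hpos
  rw [hnorm]
  set R : E → E → ℝ := fun y z => slope (fun h => M h y z) 0 h - M' y z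
  have hdec : ∀ y z, M h y z = M 0 y z + h * M' y z + h * R y z := fun y z => by
    simp only [R, slope_def_field, sub_zero]
    field_simp
    ring
  have hR : ∑ y, ∑ z, R y z * (g y * g z) ≤ ε * innerL2 π g g := by
    calc ∑ y, ∑ z, R y z * (g y * g z) ≤ ∑ y, ∑ z, ε / K * (|g y| * |g z|) := by
          refine Finset.sum_le_sum fun y _ => Finset.sum_le_sum fun z _ => ?_
          refine (le_abs_self _).trans ?_
          rw [abs_mul, abs_mul]
          exact mul_le_mul_of_nonneg_right (hh y z) (by positivity)
      _ = ε / K * (∑ x, |g x|) ^ 2 := by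
          rw [sq, Finset.sum_mul_sum]
          simp only [Finset.mul_sum]
      _ ≤ ε / K * (K * innerL2 π g g) :=
          mul_le_mul_of_nonneg_left (sum_abs_sq_le_mul_innerL2 hπ g) (by positivity)
      _ = _ := by field_simp
  have hle := (topEigenvalue_spec X P hπ f r).2.2 g
  have hexp := Real.add_one_le_exp (h * (2 * μ + ε))
  calc ∑ y, ∑ z, M h y z * (g y * g z)
      = innerL2 π g g + h * (2 * (innerL2 π (generator X P g) g +
          r * innerL2 π (LinearMap.mulLeft ℝ f g) g)) + h * ∑ y, ∑ z, R y z * (g y * g z) := by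
        rw [← hM0, ← hM1]
        simp only [hdec, Finset.mul_sum, ← Finset.sum_add_distrib]
        exact Finset.sum_congr rfl fun x _ => Finset.sum_congr rfl fun y _ => by ring
    _ ≤ innerL2 π g g + h * (2 * (μ * innerL2 π g g)) + h * (ε * innerL2 π g g) := by gcongr
    _ = (h * (2 * μ + ε) + 1) * innerL2 π g g := by ring
    _ ≤ _ := mul_le_mul_of_nonneg_right hexp (innerL2_self_nonneg (fun x => (hπ x).le) g)

/-- Start from ‖1‖₂ = 1: n steps of size t/n multiply the squared norm by at most exp(t(2λ₀(r)+ε)).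
Pairing with dν/dπ costs its norm by Cauchy–Schwarz. -/
theorem IsMarkovJumpProcess.sum_mgf_le [Nonempty E] (hX : IsMarkovJumpProcess X P)
    (hπ : ∀ x, 0 < π x) (hsum : ∑ x, π x = 1) (f : E → ℝ) {t : ℝ≥0} (ht : 0 < t) (r : ℝ)
    (ν : E → ℝ) :
    ∑ x, ν x * ProbabilityTheory.mgf (additive X f t) (P x) r ≤
      normL2 π (fun x => ν x / π x) * Real.exp (t * topEigenvalue X P π f r) := by
  set μ := topEigenvalue X P π f r
  set N := normL2 π (fun x => ν x / π x)
  have hε : ∀ ε : ℝ, 0 < ε → ∑ x, ν x * ProbabilityTheory.mgf (additive X f t) (P x) r ≤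
      N * Real.exp (t * (2 * μ + ε) / 2) := by
    intro ε hε
    set v : ℕ → E → ℝ := fun n => (weightedStep X P (t / n)
        (fun y => Real.exp ((t / n : ℝ≥0) * (r * f y))))^[n] 1
    have hlim : Tendsto (fun n => ∑ x, ν x * v n x) atTop
        (𝓝 (∑ x, ν x * ProbabilityTheory.mgf (additive X f t) (P x) r)) :=
      tendsto_finsetSum _ fun x _ => (hX.tendsto_weightedStep f ht r x).const_mul _
    have hstep : Tendsto (fun n : ℕ => (t / n : ℝ)) atTop (𝓝[>] 0) :=
      tendsto_nhdsWithin_iff.2 ⟨tendsto_const_div_atTop_nhds_zero_nat (t : ℝ),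
        (eventually_gt_atTop 0).mono fun n hn =>
          div_pos (NNReal.coe_pos.2 ht) (Nat.cast_pos.2 hn)⟩
    refine le_of_tendsto hlim ?_
    filter_upwards [hstep.eventually (hX.eventually_weightedStep_le hπ f r hε),
      eventually_gt_atTop 0] with n hn hn0
    have hn' : (0 : ℝ) < n := Nat.cast_pos.2 hn0
    have e1 : (t / n : ℝ).toNNReal = t / n := by
      rw [show (t / n : ℝ) = ((t / n : ℝ≥0) : ℝ) by push_cast; rfl, Real.toNNReal_coe]
    rw [e1] at hn
    set W : (E → ℝ) → E → ℝ := weightedStep X P (t / n)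
        (fun y => Real.exp ((t / n : ℝ≥0) * (r * f y)))
    have hW : ∀ g, innerL2 π (W g) (W g) ≤
        Real.exp (t / n * (2 * μ + ε)) * innerL2 π g g := fun g => by
      have := hn g
      simpa [W] using this
    have hone : innerL2 π 1 1 = 1 := by simpa [innerL2] using hsum
    have hiter : ∀ m, innerL2 π (W^[m] 1) (W^[m] 1) ≤ Real.exp (m * (t / n * (2 * μ + ε))) := by
      intro m
      induction m with
      | zero => simp [hone]
      | succ m ih =>
        rw [Function.iterate_succ_apply']
        refine (hW _).trans ((mul_le_mul_of_nonneg_left ih (Real.exp_pos _).le).trans_eq ?_)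
        rw [← Real.exp_add]
        push_cast
        ring_nf
    have hv : normL2 π (v n) ≤ Real.exp (t * (2 * μ + ε) / 2) := by
      rw [normL2, Real.exp_half]
      refine Real.sqrt_le_sqrt ((hiter n).trans_eq ?_)
      congr 1
      field_simp
    have e2 : ∑ x, ν x * v n x = innerL2 π (fun x => ν x / π x) (v n) :=
      Finset.sum_congr rfl fun x _ => by
        have := (hπ x).ne'
        field_simp
    rw [e2]
    exact (innerL2_le_normL2_mul (fun x => (hπ x).le) _ _).trans
      (mul_le_mul_of_nonneg_left hv (Real.sqrt_nonneg _))
  have hlim : Tendsto (fun ε : ℝ => N * Real.exp (t * (2 * μ + ε) / 2)) (𝓝[>] 0)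
      (𝓝 (N * Real.exp (t * μ))) := by
    have hc : Continuous fun ε : ℝ => N * Real.exp (t * (2 * μ + ε) / 2) := by fun_prop
    have h0 := (hc.tendsto 0).mono_left (nhdsWithin_le_nhds (s := Set.Ioi 0))
    convert h0 using 4
    ring
  exact ge_of_tendsto hlim (eventually_mem_nhdsWithin.mono hε)

/-- Chernoff's inequality under each P_x, averaged over ν. The sign of r matters here. -/
theorem IsMarkovJumpProcess.lawFrom_le [Nonempty E] (hX : IsMarkovJumpProcess X P)
    (hπ : ∀ x, 0 < π x) (hsum : ∑ x, π x = 1) (f : E → ℝ) {ν : E → ℝ} (hν : ∀ x, 0 ≤ ν x)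
    {t : ℝ≥0} (ht : 0 < t) {r : ℝ} (hr : 0 ≤ r) (u : ℝ) :
    lawFrom P ν {ω | u ≤ additive X f t ω / t} ≤
      ENNReal.ofReal (normL2 π (fun x => ν x / π x)) *
        ENNReal.ofReal (Real.exp (-(t * (r * u - topEigenvalue X P π f r)))) := by
  have ht' : (0 : ℝ) < t := ht
  have hset : {ω | u ≤ additive X f t ω / t} = {ω | u * t ≤ additive X f t ω} := by
    ext ω
    exact le_div_iff₀ ht'
  have hx : ∀ x, (P x).real {ω | u * t ≤ additive X f t ω} ≤
      Real.exp (-r * (u * t)) * ProbabilityTheory.mgf (additive X f t) (P x) r := by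
    intro x
    have := hX.isProbabilityMeasure x
    refine ProbabilityTheory.measure_ge_le_exp_mul_mgf _ hr ?_
    refine Integrable.of_bound (Real.measurable_exp.comp
      ((hX.measurable_additive f ht).const_mul r)).aestronglyMeasurable
      (Real.exp (r * ((∑ x, |f x|) * t))) (.of_forall fun ω => ?_)
    rw [Real.norm_eq_abs, Real.abs_exp, Real.exp_le_exp]
    exact mul_le_mul_of_nonneg_left
      ((le_abs_self _).trans (abs_additive_le X f ht'.le ω)) hr
  have hlaw : lawFrom P ν {ω | u * t ≤ additive X f t ω} =
      ENNReal.ofReal (∑ x, ν x * (P x).real {ω | u * t ≤ additive X f t ω}) := by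
    rw [lawFrom, Measure.finsetSum_apply,
      ENNReal.ofReal_sum_of_nonneg fun x _ => mul_nonneg (hν x) measureReal_nonneg]
    refine Finset.sum_congr rfl fun x _ => ?_
    have := hX.isProbabilityMeasure x
    rw [ENNReal.ofReal_mul (hν x), ofReal_measureReal, Measure.smul_apply, smul_eq_mul]
  rw [hset, hlaw, ← ENNReal.ofReal_mul (by exact Real.sqrt_nonneg _)]
  refine ENNReal.ofReal_le_ofReal ?_
  calc ∑ x, ν x * (P x).real {ω | u * t ≤ additive X f t ω}
      ≤ ∑ x, ν x * (Real.exp (-r * (u * t)) *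
          ProbabilityTheory.mgf (additive X f t) (P x) r) :=
        Finset.sum_le_sum fun x _ => mul_le_mul_of_nonneg_left (hx x) (hν x)
    _ = Real.exp (-r * (u * t)) * ∑ x, ν x * ProbabilityTheory.mgf (additive X f t) (P x) r := by
        rw [Finset.mul_sum]
        exact Finset.sum_congr rfl fun x _ => by ring
    _ ≤ Real.exp (-r * (u * t)) * (normL2 π (fun x => ν x / π x) *
          Real.exp (t * topEigenvalue X P π f r)) :=
        mul_le_mul_of_nonneg_left (hX.sum_mgf_le hπ hsum f ht r ν) (Real.exp_pos _).le
    _ = _ := by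
        rw [mul_left_comm, ← Real.exp_add]
        ring_nf

end

end MarkovJump

/-! ### The theorem. -/

theorem theorem3p9 {E Ω : Type*} [Fintype E] [MeasurableSpace E] [DiscreteMeasurableSpace E]
    [MeasurableSpace Ω] (X : ℝ≥0 → Ω → E) (P : E → Measure Ω)
    (hX : MarkovJump.IsMarkovJumpProcess X P) (hirr : MarkovJump.Irreducible X P)
    (π : E → ℝ) (hπ : MarkovJump.IsInvariant X P π)
    (f : E → ℝ) (hf : ∑ x, f x * π x = 0)
    (ν : E → ℝ) (hν : ν ∈ stdSimplex ℝ E) :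
    -- the objects in the statement are well defined: the density `ν / π`, the generator `L`
    -- as the limit of `(P_h g - g) / h`, and the largest eigenvalue `λ₀(r)`
    (∀ x, 0 < π x) ∧
    (∀ (g : E → ℝ) (x : E),
      Tendsto (fun h : ℝ => (MarkovJump.semigroup X P h.toNNReal g x - g x) / h) (𝓝[>] 0)
        (𝓝 (MarkovJump.generator X P g x))) ∧
    (∀ r : ℝ, IsGreatest (MarkovJump.eigenvalues (MarkovJump.tilted X P π f r))
      (MarkovJump.topEigenvalue X P π f r)) ∧
    -- the concentration inequality
    (∀ u : ℝ, 0 ≤ u → ∀ t : ℝ, 0 < t →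
      MarkovJump.lawFrom P ν {ω | u ≤ MarkovJump.additive X f t ω / t} ≤
        ENNReal.ofReal (MarkovJump.normL2 π (fun x => ν x / π x)) *
          EReal.exp (-((t : EReal) *
            MarkovJump.fenchel Set.univ (MarkovJump.topEigenvalue X P π f) u))) ∧
    -- for `u ≥ 0` the supremum may be restricted to `r ≥ 0`
    (∀ u : ℝ, 0 ≤ u →
      MarkovJump.fenchel Set.univ (MarkovJump.topEigenvalue X P π f) u =
        MarkovJump.fenchel (Set.Ici 0) (MarkovJump.topEigenvalue X P π f) u) ∧
    -- the variational formula
    (∀ u : ℝ, MarkovJump.fenchel Set.univ (MarkovJump.topEigenvalue X P π f) u =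
      MarkovJump.rateFunction X P π f u) := by
  have hpos := hX.invariant_pos hirr hπ
  have : Nonempty E := by
    by_contra h
    rw [not_nonempty_iff] at h
    simpa using hπ.1.2
  have hfen : ∀ u : ℝ, 0 ≤ u → MarkovJump.fenchel Set.univ (MarkovJump.topEigenvalue X P π f) u =
      MarkovJump.fenchel (Set.Ici 0) (MarkovJump.topEigenvalue X P π f) u := fun u hu =>
    MarkovJump.fenchel_univ_eq_of_nonneg (hX.topEigenvalue_zero hpos hπ f)
      (hX.topEigenvalue_nonneg hpos hf) hu
  refine ⟨hpos, hX.tendsto_generator,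
    fun r => (MarkovJump.topEigenvalue_spec X P hpos f r).1, fun u hu t ht => ?_, hfen,
    hX.fenchel_eq_rateFunction hpos hπ f⟩
  -- Chernoff is available only for r ≥ 0, so the supremum is first restricted.
  rw [hfen u hu]
  refine MarkovJump.le_mul_exp_neg_mul_fenchel ht ?_ fun r hr => ?_
  -- The density has positive norm, because ν has total mass 1 and cannot vanish.
  · refine Real.sqrt_pos.2 (MarkovJump.innerL2_self_pos hpos fun h => ?_)
    have h0 : ∀ x, ν x = 0 := fun x =>
      (div_eq_zero_iff.1 (congrFun h x)).resolve_right (hpos x).ne'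
    simpa [h0] using hν.2
  · lift t to ℝ≥0 using ht.le
    exact hX.lawFrom_le hpos hπ.1.2 f hν.1 (by exact_mod_cast ht) hr u
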